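/- Let $2<p<\infty$. For $x\in\mathbb{R}^n$ and $1\le q<\infty$ write $|\!|\!|x|\!|\!|_q=\bigl(\frac1n\sum_{i=1}^n|x_i|^q\bigr)^{1/q}$. For each $n\ge 1$ let $G_n$ be an $n\times n$ random matrix whose entries are i.i.d. standard Gaussian random variables, with all the matrices $G_n$ defined on one common probability space (no assumption is made on the joint law of different $G_n$). For $u,t>0$ set $$L_{n,p,u}(t)=\max_{x\in\mathbb{R}^n:\,|\!|\!|x|\!|\!|_2^2=u}\Bigl(\frac{\langle G_nx,x\rangle}{n^{3/2}}-t\,|\!|\!|x|\!|\!|_p^p\Bigr),\qquad L_{n,p}(t)=\max_{x\in\mathbb{R}^n}\Bigl(\frac{\langle G_nx,x\rangle}{n^{3/2}}-t\,|\!|\!|x|\!|\!|_p^p\Bigr).$$ Then there are deterministic real numbers $L_{p,u}(t)$ and $L_p(t)$ ($u,t>0$), depending only on $p,u,t$ and on $p,t$ respectively, such that every $L_{n,p,u}(t)$ is integrable, $$\lim_{n\to\infty}\mathbb{E}L_{n,p,u}(t)=L_{p,u}(t)\quad\text{for all }u,t>0,\qquad L_p(t)=\sup_{u>0}L_{p,u}(t)\quad\text{for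 all }t>0,$$ and, almost surely, $$\lim_{n\to\infty}L_{n,p,u}(t)=L_{p,u}(t)\ \text{ for all }u,t>0\text{ simultaneously},\qquad \lim_{n\to\infty}L_{n,p}(t)=L_p(t)\ \text{ for all }t>0\text{ simultaneously}.$$ -/

import Mathlib

open MeasureTheory ProbabilityTheory Filter Topology Matrix

noncomputable section

/-- The normalized `ℓ_p`-norm `(n⁻¹ ∑ᵢ |xᵢ|^p)^{1/p}` of a vector `x ∈ ℝⁿ`, for finite `p`. -/
def normalizedNorm {n : ℕ} (p : ℝ) (x : Fin n → ℝ) : ℝ :=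
  ((1 / (n : ℝ)) * ∑ i, |x i| ^ p) ^ (1 / p)

/-- The penalized energy `⟨A x, x⟩ / n^{3/2} - t ‖x‖_p^p`, with the normalized `ℓ_p`-norm. -/
def penalizedEnergy {n : ℕ} (p t : ℝ) (A : Matrix (Fin n) (Fin n) ℝ) (x : Fin n → ℝ) : ℝ :=
  ((A *ᵥ x) ⬝ᵥ x) / (n : ℝ) ^ (3 / 2 : ℝ) - t * normalizedNorm p x ^ p

/-- The maximum of the penalized energy over all `x ∈ ℝⁿ`. -/
def groundStateEnergy {n : ℕ} (p t : ℝ) (A : Matrix (Fin n) (Fin n) ℝ) : ℝ :=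
  sSup (Set.range (penalizedEnergy p t A))

/-- The maximum of the penalized energy over all `x ∈ ℝⁿ` with self-overlap `‖x‖₂² = u`,
for the normalized `ℓ_2`-norm. -/
def constrainedGroundStateEnergy {n : ℕ} (p u t : ℝ) (A : Matrix (Fin n) (Fin n) ℝ) : ℝ :=
  sSup (penalizedEnergy p t A '' {x | normalizedNorm 2 x ^ 2 = u})

/-- `G` is an `n × n` random matrix on `(Ω, P)` with i.i.d. standard Gaussian entries. -/
structure IsGaussianMatrix {Ω : Type*} [MeasurableSpace Ω] (P : Measure Ω) {n : ℕ}
    (G : Ω → Matrix (Fin n) (Fin n) ℝ) : Prop where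
  indep : iIndepFun (fun (ij : Fin n × Fin n) ω => G ω ij.1 ij.2) P
  law : ∀ i j, HasLaw (fun ω => G ω i j) (gaussianReal 0 1) P

lemma normalizedNorm_rpow {n : ℕ} {p : ℝ} (hp : 0 < p) (x : Fin n → ℝ) :
    normalizedNorm p x ^ p = (1 / (n : ℝ)) * ∑ i, |x i| ^ p := by
  unfold normalizedNorm
  rw [← Real.rpow_mul (by positivity), one_div_mul_cancel hp.ne', Real.rpow_one]

lemma normalizedNorm_two_sq {n : ℕ} (x : Fin n → ℝ) :
    normalizedNorm 2 x ^ 2 = (1 / (n : ℝ)) * ∑ i, x i ^ 2 := by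
  have h := normalizedNorm_rpow (n := n) (p := 2) (by norm_num) x
  simpa using h

lemma continuous_penalizedEnergy {n : ℕ} {p : ℝ} (hp : 0 < p) (t : ℝ)
    (A : Matrix (Fin n) (Fin n) ℝ) : Continuous (penalizedEnergy p t A) := by
  unfold penalizedEnergy
  simp only [normalizedNorm_rpow hp, Matrix.mulVec, dotProduct]
  refine Continuous.sub (Continuous.div_const (by fun_prop) _) ?_
  refine continuous_const.mul (continuous_const.mul ?_)
  exact continuous_finsetSum _ fun i _ =>
    (continuous_apply i).abs.rpow_const fun _ => Or.inr hp.le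

/-- The supremum in the definition of `constrainedGroundStateEnergy` is an attained maximum. -/
lemma isGreatest_constrainedGroundStateEnergy {n : ℕ} (hn : 0 < n) {p : ℝ} (hp : 2 < p)
    {u : ℝ} (hu : 0 < u) (t : ℝ) (A : Matrix (Fin n) (Fin n) ℝ) :
    IsGreatest (penalizedEnergy p t A '' {x | normalizedNorm 2 x ^ 2 = u})
      (constrainedGroundStateEnergy p u t A) := by
  have hn' : (0 : ℝ) < n := by exact_mod_cast hn
  have hS : {x : Fin n → ℝ | normalizedNorm 2 x ^ 2 = u}
      = {x : Fin n → ℝ | (1 / (n : ℝ)) * ∑ i, x i ^ 2 = u} := by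
    ext x; simp only [Set.mem_ofPred_eq, normalizedNorm_two_sq]
  have hc : IsCompact {x : Fin n → ℝ | normalizedNorm 2 x ^ 2 = u} := by
    rw [hS]
    refine Metric.isCompact_of_isClosed_isBounded
      (isClosed_eq (by fun_prop) continuous_const) ?_
    refine (Metric.isBounded_closedBall (x := 0) (r := Real.sqrt (n * u))).subset ?_
    intro x hx
    rw [mem_closedBall_zero_iff, pi_norm_le_iff_of_nonneg (Real.sqrt_nonneg _)]
    intro i
    rw [Real.norm_eq_abs]
    apply Real.abs_le_sqrt
    have h1 : x i ^ 2 ≤ ∑ j, x j ^ 2 :=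
      Finset.single_le_sum (f := fun j => x j ^ 2) (fun j _ => sq_nonneg _) (Finset.mem_univ i)
    have h2 : ∑ j, x j ^ 2 = n * u := by
      rw [← Set.mem_ofPred_eq.mp hx]; field_simp
    linarith
  have hne : {x : Fin n → ℝ | normalizedNorm 2 x ^ 2 = u}.Nonempty := by
    rw [hS]
    refine ⟨fun _ => Real.sqrt u, ?_⟩
    simp [Real.sq_sqrt hu.le]
    field_simp
  exact (hc.image (continuous_penalizedEnergy (by linarith) t A)).isGreatest_sSup (hne.image _)

/-- The supremum in the definition of `groundStateEnergy` is an attained maximum. -/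
lemma isGreatest_groundStateEnergy {n : ℕ} (hn : 0 < n) {p : ℝ} (hp : 2 < p)
    {t : ℝ} (ht : 0 < t) (A : Matrix (Fin n) (Fin n) ℝ) :
    IsGreatest (Set.range (penalizedEnergy p t A)) (groundStateEnergy p t A) := by
  have hn' : (0 : ℝ) < n := by exact_mod_cast hn
  have : Nonempty (Fin n) := ⟨⟨0, hn⟩⟩
  have hp0 : 0 < p := by linarith
  have h0 : penalizedEnergy p t A 0 = 0 := by
    simp [penalizedEnergy, normalizedNorm_rpow hp0, Real.zero_rpow hp0.ne']
  set K : ℝ := (∑ i, ∑ j, |A i j|) / (n : ℝ) ^ (3 / 2 : ℝ) with hK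
  have hbound : ∀ x : Fin n → ℝ,
      penalizedEnergy p t A x ≤ K * ‖x‖ ^ 2 - t / n * ‖x‖ ^ p := by
    intro x
    unfold penalizedEnergy
    rw [normalizedNorm_rpow hp0]
    have hq : (A *ᵥ x) ⬝ᵥ x ≤ (∑ i, ∑ j, |A i j|) * ‖x‖ ^ 2 := by
      simp only [Matrix.mulVec, dotProduct, Finset.sum_mul]
      refine Finset.sum_le_sum fun i _ => Finset.sum_le_sum fun j _ => ?_
      have hi := norm_le_pi_norm x i
      have hj := norm_le_pi_norm x j
      rw [Real.norm_eq_abs] at hi hj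
      calc A i j * x j * x i ≤ |A i j * x j * x i| := le_abs_self _
        _ = |A i j| * (|x j| * |x i|) := by rw [abs_mul, abs_mul]; ring
        _ ≤ |A i j| * (‖x‖ * ‖x‖) := by gcongr
        _ = _ := by ring
    have hs : ‖x‖ ^ p ≤ ∑ i, |x i| ^ p := by
      obtain ⟨i, hi⟩ := Finite.exists_max (fun i => |x i|)
      have hi' : ‖x‖ ≤ |x i| := (pi_norm_le_iff_of_nonneg (abs_nonneg _)).2 hi
      refine (Real.rpow_le_rpow (norm_nonneg _) hi' hp0.le).trans ?_
      exact Finset.single_le_sum (f := fun j => |x j| ^ p)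
        (fun j _ => by positivity) (Finset.mem_univ i)
    have e1 : ((A *ᵥ x) ⬝ᵥ x) / (n : ℝ) ^ (3 / 2 : ℝ) ≤ K * ‖x‖ ^ 2 := by
      rw [hK, div_mul_eq_mul_div]; gcongr
    have e2 : t / n * ‖x‖ ^ p ≤ t * (1 / (n : ℝ) * ∑ i, |x i| ^ p) := by
      calc t / n * ‖x‖ ^ p ≤ t / n * ∑ i, |x i| ^ p := by gcongr
        _ = _ := by ring
    linarith
  have hev : ∀ᶠ x in cocompact (Fin n → ℝ), penalizedEnergy p t A x ≤ penalizedEnergy p t A 0 := by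
    have hlim := (tendsto_rpow_atTop (show (0 : ℝ) < p - 2 by linarith)).comp
      (tendsto_norm_cocompact_atTop (E := Fin n → ℝ))
    filter_upwards [hlim.eventually_ge_atTop (K * n / t),
      (tendsto_norm_cocompact_atTop (E := Fin n → ℝ)).eventually_gt_atTop 0] with x hx hx0
    rw [h0]
    refine (hbound x).trans ?_
    have e : ‖x‖ ^ p = ‖x‖ ^ 2 * ‖x‖ ^ (p - 2) := by
      rw [← Real.rpow_natCast, ← Real.rpow_add hx0]; norm_num
    have hx' : K ≤ t / n * ‖x‖ ^ (p - 2) := by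
      have := (div_le_iff₀ ht).mp hx
      rw [div_mul_eq_mul_div, le_div_iff₀ hn']
      simp only [Function.comp] at this
      linarith
    rw [e]
    nlinarith [sq_nonneg ‖x‖, mul_le_mul_of_nonneg_right hx' (sq_nonneg ‖x‖)]
  obtain ⟨x, hx⟩ := (continuous_penalizedEnergy hp0 t A).exists_forall_ge' 0 hev
  have hg : IsGreatest (Set.range (penalizedEnergy p t A)) (penalizedEnergy p t A x) :=
    ⟨⟨x, rfl⟩, by rintro _ ⟨y, rfl⟩; exact hx y⟩
  rw [groundStateEnergy, hg.csSup_eq]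
  exact hg

end

/-!
The energy `x ↦ ⟨G x, x⟩ / n^(3/2)` is a Gaussian process linear in `G`. The rank-one matrices
satisfy the convexity estimate `⟨(x, y), (x', y')⟩² / (m + k) ≤ ⟨x, x'⟩² / m + ⟨y, y'⟩² / k`, so
concatenating two systems increases the increments of the process and the Sudakov–Fernique
inequality makes `n E L_{n,p,1}(s)` superadditive, as in Guerra and Toninelli's argument. Comparison
with a linear process bounds `E L_{n,p,1}(s)`, and Fekete's lemma gives its limit. Rotating an
independent copy of `G` bounds the fourth central moment by a multiple of `n⁻²`, which is summable:
convergence holds almost surely for each `s`. Since `L_{n,p,1}` is antitone in `s` and its limit is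
convex, hence continuous on `s > 0`, the rational values of `s` suffice. The substitution `x = √u y`
gives `L_{n,p,u}(t) = u L_{n,p,1}(t u^(p/2-1))`, and the antitone dependence of the second factor on
`u` lets the limit pass through the supremum over `u`.
-/

open Real (pi_pos)
open scoped ENNReal NNReal RealInnerProductSpace

section GaussianRotation

variable {W : Type*} [NormedAddCommGroup W] [NormedSpace ℝ W]

lemma continuous_rotation {X : Type*} [TopologicalSpace X] {θ : X → ℝ} {q : X → W × W}
    (hθ : Continuous θ) (hq : Continuous q) :
    Continuous fun x => ContinuousLinearMap.rotation (θ x) (q x) := by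
  simp only [ContinuousLinearMap.rotation_apply]
  fun_prop

lemma hasDerivAt_rotation (θ : ℝ) (q : W × W) :
    HasDerivAt (fun θ => ContinuousLinearMap.rotation θ q)
      ((ContinuousLinearMap.rotation θ q).2, -(ContinuousLinearMap.rotation θ q).1) θ := by
  simp only [ContinuousLinearMap.rotation_apply, neg_add, ← neg_smul]
  exact (((Real.hasDerivAt_cos θ).smul_const q.1).add
    ((Real.hasDerivAt_sin θ).smul_const q.2)).prodMk
    (((Real.hasDerivAt_sin θ).neg.smul_const q.1).add
      ((Real.hasDerivAt_cos θ).smul_const q.2))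

lemma norm_cos_smul_add_sin_smul_le (θ : ℝ) (v w : W) :
    ‖Real.cos θ • v + Real.sin θ • w‖ ≤ ‖v‖ + ‖w‖ := by
  refine (norm_add_le _ _).trans ?_
  rw [norm_smul, norm_smul]
  exact add_le_add (mul_le_of_le_one_left (norm_nonneg _) (Real.abs_cos_le_one θ))
    (mul_le_of_le_one_left (norm_nonneg _) (Real.abs_sin_le_one θ))

lemma norm_neg_sin_smul_add_cos_smul_le (θ : ℝ) (v w : W) :
    ‖-Real.sin θ • v + Real.cos θ • w‖ ≤ ‖v‖ + ‖w‖ := by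
  simpa [Real.cos_add_pi_div_two, Real.sin_add_pi_div_two] using
    norm_cos_smul_add_sin_smul_le (θ + Real.pi / 2) v w

lemma norm_rotation_le (θ : ℝ) (q : W × W) :
    ‖ContinuousLinearMap.rotation θ q‖ ≤ ‖q.1‖ + ‖q.2‖ :=
  max_le (norm_cos_smul_add_sin_smul_le θ q.1 q.2) (norm_neg_sin_smul_add_cos_smul_le θ q.1 q.2)

variable [MeasurableSpace W] [BorelSpace W] [SecondCountableTopology W] [CompleteSpace W]
  {μ : Measure W} [IsGaussian μ]

lemma memLp_norm_fst_add_norm_snd :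
    MemLp (fun q : W × W => ‖q.1‖ + ‖q.2‖) 2 (μ.prod μ) :=
  ((IsGaussian.memLp_two_id (μ := μ)).norm.comp_fst μ).add
    ((IsGaussian.memLp_two_id (μ := μ)).norm.comp_snd μ)

/-- The infinitesimal form of the rotation invariance of `μ.prod μ`. -/
lemma integral_fderiv_rotation_eq_zero (hμ : μ[id] = 0) {g : W × W → ℝ}
    {g' : W × W → StrongDual ℝ (W × W)} (hg : ∀ q, HasFDerivAt g (g' q) q)
    (hg' : Continuous g') (hgi : Integrable g (μ.prod μ)) {C : ℝ}
    (hC : ∀ q, ‖g' q‖ ≤ C * (1 + ‖q‖)) :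
    ∫ q, g' q (q.2, -q.1) ∂(μ.prod μ) = 0 := by
  let G : ℝ → W × W → ℝ := fun θ q => g (ContinuousLinearMap.rotation θ q)
  let G' : ℝ → W × W → ℝ := fun θ q => g' (ContinuousLinearMap.rotation θ q)
    ((ContinuousLinearMap.rotation θ q).2, -(ContinuousLinearMap.rotation θ q).1)
  have hgc : Continuous g := continuous_iff_continuousAt.2 fun q => (hg q).continuousAt
  have hC0 : 0 ≤ C := by simpa using (norm_nonneg _).trans (hC 0)
  have hG0 : G 0 = g := by funext q; simp [G, ContinuousLinearMap.rotation_apply]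
  have hbound : ∀ θ q, ‖G' θ q‖ ≤ C * ((‖q.1‖ + ‖q.2‖) + (‖q.1‖ + ‖q.2‖) ^ 2) := by
    intro θ q
    set v := ContinuousLinearMap.rotation θ q
    have hv : ‖v‖ ≤ ‖q.1‖ + ‖q.2‖ := norm_rotation_le θ q
    have hv' : ‖(v.2, -v.1)‖ = ‖v‖ := by
      rw [Prod.norm_def, Prod.norm_def, norm_neg, max_comm]
    calc ‖g' v (v.2, -v.1)‖ ≤ C * (1 + ‖v‖) * ‖v‖ := by
          rw [← hv']; exact (g' v).le_of_opNorm_le (by rw [hv']; exact hC v) _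
      _ ≤ C * (1 + (‖q.1‖ + ‖q.2‖)) * (‖q.1‖ + ‖q.2‖) := by gcongr
      _ = _ := by ring
  have hderiv := (hasDerivAt_integral_of_dominated_loc_of_deriv_le (μ := μ.prod μ) (F := G)
    (F' := G') (x₀ := (0 : ℝ)) (s := Set.univ) univ_mem
    (Eventually.of_forall fun θ => (hgc.comp (by fun_prop)).aestronglyMeasurable)
    (by rwa [hG0]) ((hg'.comp (by fun_prop)).clm_apply (by fun_prop)).aestronglyMeasurable
    (Eventually.of_forall fun q θ _ => hbound θ q)
    (((memLp_norm_fst_add_norm_snd.integrable one_le_two).add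
      memLp_norm_fst_add_norm_snd.integrable_sq).const_mul C)
    (Eventually.of_forall fun q θ _ =>
      (hg _).comp_hasDerivAt θ (hasDerivAt_rotation θ q))).2
  have hconst : (fun θ => ∫ q, G θ q ∂(μ.prod μ)) = fun _ => ∫ q, g q ∂(μ.prod μ) := by
    funext θ
    conv_rhs => rw [← IsGaussian.map_rotation_eq_self hμ θ]
    rw [integral_map (by fun_prop) hgc.aestronglyMeasurable]
  rw [hconst] at hderiv
  simpa [G', ContinuousLinearMap.rotation_apply] using hderiv.unique (hasDerivAt_const _ _)

lemma integrable_fst_apply_snd_mul_snd {h' : W → StrongDual ℝ W} (hc : Continuous h') {C : ℝ}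
    (hC : ∀ w, ‖h' w‖ ≤ C) (L : StrongDual ℝ W) :
    Integrable (fun q : W × W => h' q.1 q.2 * L q.2) (μ.prod μ) := by
  refine (((IsGaussian.memLp_two_id (μ := μ)).comp_snd μ).norm.integrable_sq.const_mul
    (C * ‖L‖)).mono' (by fun_prop) (Eventually.of_forall fun q => ?_)
  calc ‖h' q.1 q.2 * L q.2‖ ≤ C * ‖q.2‖ * (‖L‖ * ‖q.2‖) := by
        rw [norm_mul]
        exact mul_le_mul ((h' q.1).le_of_opNorm_le (hC _) _) (L.le_opNorm _) (norm_nonneg _)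
          (mul_nonneg ((norm_nonneg _).trans (hC 0)) (norm_nonneg _))
    _ = C * ‖L‖ * ‖q.2‖ ^ 2 := by ring

lemma covarianceBilinDual_eq_integral_mul (hμ : μ[id] = 0) (L M : StrongDual ℝ W) :
    covarianceBilinDual μ L M = ∫ w, L w * M w ∂μ := by
  simp only [covarianceBilinDual_apply' IsGaussian.memLp_two_id, hμ, sub_zero]

/-- **Gaussian integration by parts** for a centered Gaussian measure on a Banach space. -/
theorem integral_mul_dual_eq_integral_covarianceBilinDual (hμ : μ[id] = 0) {h : W → ℝ}
    {h' : W → StrongDual ℝ W} (hd : ∀ w, HasFDerivAt h (h' w) w) (hc : Continuous h') {C : ℝ}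
    (hC : ∀ w, |h w| ≤ C) (hC' : ∀ w, ‖h' w‖ ≤ C) (L : StrongDual ℝ W) :
    ∫ w, h w * L w ∂μ = ∫ w, covarianceBilinDual μ (h' w) L ∂μ := by
  have hh : Continuous h := continuous_iff_continuousAt.2 fun w => (hd w).continuousAt
  have hC0 : 0 ≤ C := (abs_nonneg _).trans (hC 0)
  have hbdd : ∀ᵐ w ∂μ, ‖h w‖ ≤ C := Eventually.of_forall hC
  have hi : Integrable (fun w => h w * L w) μ :=
    (IsGaussian.integrable_dual μ L).bdd_mul hh.aestronglyMeasurable hbdd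
  have hrot := integral_fderiv_rotation_eq_zero hμ (g := fun q => h q.1 * L q.2)
    (g' := fun q => h q.1 • L.comp (.snd ℝ W W) + L q.2 • (h' q.1).comp (.fst ℝ W W))
    (C := C * ‖L‖) (fun q => ((hd q.1).comp q hasFDerivAt_fst).mul
      (L.hasFDerivAt.comp q hasFDerivAt_snd)) (by fun_prop)
    (((IsGaussian.integrable_dual μ L).comp_snd μ).bdd_mul
      (hh.comp continuous_fst).aestronglyMeasurable (Eventually.of_forall fun q => hC q.1))
    fun q => by
      calc ‖h q.1 • L.comp (.snd ℝ W W) + L q.2 • (h' q.1).comp (.fst ℝ W W)‖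
          ≤ C * ‖L‖ + ‖L‖ * ‖q‖ * C := by
            refine (norm_add_le _ _).trans ?_
            rw [norm_smul, norm_smul]
            gcongr
            · exact hC _
            · exact (L.opNorm_comp_le _).trans
                (mul_le_of_le_one_right (norm_nonneg _) (ContinuousLinearMap.norm_snd_le ℝ W W))
            · exact (L.le_opNorm _).trans (by gcongr; exact norm_snd_le q)
            · exact ((h' _).opNorm_comp_le _).trans ((mul_le_of_le_one_right (norm_nonneg _)
                (ContinuousLinearMap.norm_fst_le ℝ W W)).trans (hC' _))
        _ = C * ‖L‖ * (1 + ‖q‖) := by ring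
  have hrot' : ∫ q : W × W, (h' q.1 q.2 * L q.2 - h q.1 * L q.1) ∂(μ.prod μ) = 0 := by
    rw [← hrot]
    refine integral_congr_ae (Eventually.of_forall fun q => ?_)
    simp [mul_comm, sub_eq_neg_add]
  rw [integral_sub (integrable_fst_apply_snd_mul_snd hc hC' L) (hi.comp_fst μ), sub_eq_zero,
    integral_prod _ (integrable_fst_apply_snd_mul_snd hc hC' L),
    integral_fun_fst (fun w => h w * L w), probReal_univ, one_smul] at hrot'
  simp_rw [covarianceBilinDual_eq_integral_mul hμ]
  exact hrot'.symm

end GaussianRotation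

section MaureyPisier

lemma enorm_integral_rpow_le {α : Type*} [MeasurableSpace α] {ν : Measure α} {f : α → ℝ}
    (hf : AEStronglyMeasurable f ν) {r : ℝ≥0} (hr : 1 ≤ r) :
    ‖∫ x, f x ∂ν‖ₑ ^ (r : ℝ) ≤ ν Set.univ ^ (r - 1 : ℝ) * ∫⁻ x, ‖f x‖ₑ ^ (r : ℝ) ∂ν := by
  have hr0 : (0 : ℝ) < r := lt_of_lt_of_le one_pos (by exact_mod_cast hr)
  have hHolder : ∫⁻ x, ‖f x‖ₑ ∂ν ≤ eLpNorm f r ν * ν Set.univ ^ (1 - 1 / r : ℝ) := by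
    simpa [eLpNorm_one_eq_lintegral_enorm] using
      eLpNorm_le_eLpNorm_mul_rpow_measure_univ (p := 1) (q := r) (by exact_mod_cast hr) hf
  calc ‖∫ x, f x ∂ν‖ₑ ^ (r : ℝ)
      ≤ (eLpNorm f r ν * ν Set.univ ^ (1 - 1 / r : ℝ)) ^ (r : ℝ) := by
        gcongr; exact (enorm_integral_le_lintegral_enorm f).trans hHolder
    _ = ν Set.univ ^ (r - 1 : ℝ) * ∫⁻ x, ‖f x‖ₑ ^ (r : ℝ) ∂ν := by
        rw [ENNReal.mul_rpow_of_nonneg _ _ hr0.le, ← ENNReal.rpow_mul,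
          eLpNorm_nnreal_pow_eq_lintegral (by exact_mod_cast hr0.ne'), sub_mul, one_mul,
          one_div_mul_cancel hr0.ne', mul_comm]

lemma eLpNorm_sub_integral_le {α : Type*} [MeasurableSpace α] {ν : Measure α}
    [IsProbabilityMeasure ν] {f : α → ℝ} (hf : Integrable f ν) {r : ℝ≥0} (hr : 1 ≤ r) :
    eLpNorm (fun x => f x - ∫ y, f y ∂ν) r ν
      ≤ eLpNorm (fun q : α × α => f q.2 - f q.1) r (ν.prod ν) := by
  have hr0 : r ≠ 0 := (one_pos.trans_le hr).ne'
  have hm : AEMeasurable (fun q : α × α => ‖f q.2 - f q.1‖ₑ ^ (r : ℝ)) (ν.prod ν) :=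
    (hf.aemeasurable.comp_snd.sub hf.aemeasurable.comp_fst).enorm.pow_const _
  rw [← ENNReal.rpow_le_rpow_iff (z := r) (by positivity), eLpNorm_nnreal_pow_eq_lintegral hr0,
    eLpNorm_nnreal_pow_eq_lintegral hr0]
  calc ∫⁻ x, ‖f x - ∫ y, f y ∂ν‖ₑ ^ (r : ℝ) ∂ν
      = ∫⁻ x, ‖∫ y, (f x - f y) ∂ν‖ₑ ^ (r : ℝ) ∂ν := by
        simp_rw [integral_sub (integrable_const _) hf, integral_const, probReal_univ, one_smul]
    _ ≤ ∫⁻ x, ∫⁻ y, ‖f x - f y‖ₑ ^ (r : ℝ) ∂ν ∂ν := lintegral_mono fun x => by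
        simpa using enorm_integral_rpow_le (aestronglyMeasurable_const.sub hf.1) hr
    _ = ∫⁻ q : α × α, ‖f q.2 - f q.1‖ₑ ^ (r : ℝ) ∂(ν.prod ν) := by
        simp_rw [lintegral_prod _ hm, enorm_sub_rev]

variable {W : Type*} [NormedAddCommGroup W] [NormedSpace ℝ W] {f : W → ℝ} {f' : W → StrongDual ℝ W}

lemma sub_eq_integral_fderiv_rotation (hf : ∀ w, HasFDerivAt f (f' w) w) (hc : Continuous f')
    (q : W × W) : f q.2 - f q.1 = ∫ θ in 0..Real.pi / 2,
      f' (ContinuousLinearMap.rotation θ q).1 (ContinuousLinearMap.rotation θ q).2 := by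
  have hrot : Continuous fun θ => ContinuousLinearMap.rotation θ q :=
    continuous_rotation continuous_id continuous_const
  have hderiv : ∀ θ, HasDerivAt (fun θ => f (ContinuousLinearMap.rotation θ q).1)
      (f' (ContinuousLinearMap.rotation θ q).1 (ContinuousLinearMap.rotation θ q).2) θ := fun θ =>
    (hf _).comp_hasDerivAt θ (hasDerivAt_rotation θ q).fst
  rw [intervalIntegral.integral_eq_sub_of_hasDerivAt (fun θ _ => hderiv θ)
    ((hc.comp hrot.fst).clm_apply hrot.snd |>.intervalIntegrable _ _)]
  simp [ContinuousLinearMap.rotation_apply]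

lemma enorm_sub_rpow_le_lintegral_rotation (hf : ∀ w, HasFDerivAt f (f' w) w)
    (hc : Continuous f') {r : ℝ≥0} (hr : 1 ≤ r) (q : W × W) :
    ‖f q.2 - f q.1‖ₑ ^ (r : ℝ) ≤ ENNReal.ofReal (Real.pi / 2) ^ (r - 1 : ℝ) *
      ∫⁻ θ in Set.Ioc 0 (Real.pi / 2), ‖f' (ContinuousLinearMap.rotation θ q).1
        (ContinuousLinearMap.rotation θ q).2‖ₑ ^ (r : ℝ) := by
  have hrot : Continuous fun θ => ContinuousLinearMap.rotation θ q :=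
    continuous_rotation continuous_id continuous_const
  rw [sub_eq_integral_fderiv_rotation hf hc,
    intervalIntegral.integral_of_le (div_nonneg pi_pos.le zero_le_two)]
  refine (enorm_integral_rpow_le
    ((hc.comp hrot.fst).clm_apply hrot.snd).aestronglyMeasurable hr).trans_eq ?_
  simp

variable [MeasurableSpace W] [BorelSpace W] [SecondCountableTopology W] [CompleteSpace W]
  {μ : Measure W} [IsGaussian μ]

lemma lintegral_fderiv_rotation_rpow_le (hμ : μ[id] = 0) (hc : Continuous f') {r : ℝ≥0}
    (hr : 1 ≤ r) {B : ℝ≥0∞} (hB : ∀ w, eLpNorm (f' w) r μ ≤ B) (θ : ℝ) :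
    ∫⁻ q, ‖f' (ContinuousLinearMap.rotation θ q).1 (ContinuousLinearMap.rotation θ q).2‖ₑ ^ (r : ℝ)
      ∂(μ.prod μ) ≤ B ^ (r : ℝ) := by
  have hm : Measurable fun q : W × W => ‖f' q.1 q.2‖ₑ ^ (r : ℝ) :=
    (((hc.comp continuous_fst).clm_apply continuous_snd).enorm.measurable).pow_const _
  calc _ = ∫⁻ q, ‖f' q.1 q.2‖ₑ ^ (r : ℝ) ∂(μ.prod μ) := by
        conv_rhs => rw [← IsGaussian.map_rotation_eq_self hμ θ]
        rw [lintegral_map hm (by fun_prop)]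
    _ = ∫⁻ w, eLpNorm (f' w) r μ ^ (r : ℝ) ∂μ := by
        simp_rw [lintegral_prod _ hm.aemeasurable,
          eLpNorm_nnreal_pow_eq_lintegral (one_pos.trans_le hr).ne']
    _ ≤ ∫⁻ _, B ^ (r : ℝ) ∂μ := by gcongr; exact hB _
    _ = B ^ (r : ℝ) := by simp

/-- The **Maurey–Pisier inequality**. -/
theorem eLpNorm_sub_le_of_eLpNorm_fderiv_le (hμ : μ[id] = 0) (hf : ∀ w, HasFDerivAt f (f' w) w)
    (hc : Continuous f') {r : ℝ≥0} (hr : 1 ≤ r) {B : ℝ≥0∞} (hB : ∀ w, eLpNorm (f' w) r μ ≤ B) :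
    eLpNorm (fun q : W × W => f q.2 - f q.1) r (μ.prod μ) ≤ ENNReal.ofReal (Real.pi / 2) * B := by
  have hr0 : (0 : ℝ) < r := one_pos.trans_le (by exact_mod_cast hr)
  have hpi : ENNReal.ofReal (Real.pi / 2) ≠ 0 := by simp [pi_pos]
  have hm : AEMeasurable (fun x : (W × W) × ℝ => ‖f' (ContinuousLinearMap.rotation x.2 x.1).1
      (ContinuousLinearMap.rotation x.2 x.1).2‖ₑ ^ (r : ℝ))
      ((μ.prod μ).prod (volume.restrict (Set.Ioc 0 (Real.pi / 2)))) := by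
    have hrot : Continuous fun x : (W × W) × ℝ => ContinuousLinearMap.rotation x.2 x.1 :=
      continuous_rotation continuous_snd continuous_fst
    exact (((hc.comp hrot.fst).clm_apply hrot.snd).enorm.measurable.pow_const _).aemeasurable
  rw [← ENNReal.rpow_le_rpow_iff (z := r) hr0,
    eLpNorm_nnreal_pow_eq_lintegral (by exact_mod_cast hr0.ne'),
    ENNReal.mul_rpow_of_nonneg _ _ hr0.le]
  calc ∫⁻ q : W × W, ‖f q.2 - f q.1‖ₑ ^ (r : ℝ) ∂(μ.prod μ)
      ≤ ∫⁻ q, (ENNReal.ofReal (Real.pi / 2) ^ (r - 1 : ℝ) * ∫⁻ θ in Set.Ioc 0 (Real.pi / 2),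
          ‖f' (ContinuousLinearMap.rotation θ q).1 (ContinuousLinearMap.rotation θ q).2‖ₑ ^ (r : ℝ))
          ∂(μ.prod μ) := lintegral_mono (enorm_sub_rpow_le_lintegral_rotation hf hc hr)
    _ = ENNReal.ofReal (Real.pi / 2) ^ (r - 1 : ℝ) * ∫⁻ θ in Set.Ioc 0 (Real.pi / 2), (∫⁻ q,
          ‖f' (ContinuousLinearMap.rotation θ q).1 (ContinuousLinearMap.rotation θ q).2‖ₑ ^ (r : ℝ)
          ∂(μ.prod μ)) := by
        rw [lintegral_const_mul' _ _ (ENNReal.rpow_ne_top_of_ne_zero hpi ENNReal.ofReal_ne_top),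
          lintegral_lintegral_swap hm]
    _ ≤ ENNReal.ofReal (Real.pi / 2) ^ (r - 1 : ℝ) *
          ∫⁻ _ in Set.Ioc 0 (Real.pi / 2), B ^ (r : ℝ) := by
        gcongr with θ; exact lintegral_fderiv_rotation_rpow_le hμ hc hr hB θ
    _ = ENNReal.ofReal (Real.pi / 2) ^ (r : ℝ) * B ^ (r : ℝ) := by
        rw [setLIntegral_const, Real.volume_Ioc, sub_zero, mul_comm (B ^ _), ← mul_assoc]
        nth_rw 2 [← ENNReal.rpow_one (ENNReal.ofReal (Real.pi / 2))]
        rw [← ENNReal.rpow_add _ _ hpi ENNReal.ofReal_ne_top, sub_add_cancel]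

end MaureyPisier

section LogSumExp

variable {K : Type*} [Fintype K]

/-- The log-sum-exp function `log ∑ₖ exp zₖ`, a smooth approximation of the maximum. -/
noncomputable def logSumExp (z : K → ℝ) : ℝ := Real.log (∑ k, Real.exp (z k))

/-- The softmax weights, that is the gradient of `logSumExp`. -/
noncomputable def softmax (z : K → ℝ) (k : K) : ℝ := Real.exp (z k) / ∑ l, Real.exp (z l)

lemma sum_exp_pos [Nonempty K] (z : K → ℝ) : 0 < ∑ k, Real.exp (z k) :=
  Finset.sum_pos (fun _ _ => Real.exp_pos _) Finset.univ_nonempty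

lemma softmax_nonneg (z : K → ℝ) (k : K) : 0 ≤ softmax z k := by
  unfold softmax; positivity

lemma sum_softmax [Nonempty K] (z : K → ℝ) : ∑ k, softmax z k = 1 := by
  unfold softmax
  rw [← Finset.sum_div, div_self (sum_exp_pos z).ne']

lemma softmax_le_one [Nonempty K] (z : K → ℝ) (k : K) : softmax z k ≤ 1 := by
  rw [← sum_softmax z]
  exact Finset.single_le_sum (fun i _ => softmax_nonneg z i) (Finset.mem_univ k)

lemma le_logSumExp (z : K → ℝ) (k : K) : z k ≤ logSumExp z := by
  rw [logSumExp, ← Real.log_exp (z k)]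
  refine Real.log_le_log (Real.exp_pos _) ?_
  exact Finset.single_le_sum (f := fun i => Real.exp (z i)) (fun i _ => (Real.exp_pos _).le)
    (Finset.mem_univ k)

lemma logSumExp_le [Nonempty K] (z : K → ℝ) {M : ℝ} (h : ∀ k, z k ≤ M) :
    logSumExp z ≤ M + Real.log (Fintype.card K) := by
  have hc : (0 : ℝ) < Fintype.card K := by exact_mod_cast Fintype.card_pos
  rw [logSumExp, ← Real.log_exp M, ← Real.log_mul (Real.exp_pos _).ne' hc.ne']
  refine Real.log_le_log (sum_exp_pos z) ?_
  calc ∑ k, Real.exp (z k) ≤ ∑ _k : K, Real.exp M :=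
        Finset.sum_le_sum fun k _ => Real.exp_le_exp.2 (h k)
    _ = _ := by simp [mul_comm]

lemma abs_logSumExp_le [Nonempty K] (z : K → ℝ) :
    |logSumExp z| ≤ ∑ k, |z k| + Real.log (Fintype.card K) := by
  have hlog : 0 ≤ Real.log (Fintype.card K) := Real.log_natCast_nonneg _
  have hle : ∀ k, |z k| ≤ ∑ k, |z k| := fun k =>
    Finset.single_le_sum (f := fun k => |z k|) (fun _ _ => abs_nonneg _) (Finset.mem_univ k)
  obtain ⟨k⟩ := ‹Nonempty K›
  rw [abs_le]
  constructor
  · linarith [le_logSumExp z k, neg_abs_le (z k), hle k]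
  · exact logSumExp_le z fun k => (le_abs_self _).trans (hle k)

lemma hasFDerivAt_logSumExp [Nonempty K] (z : K → ℝ) :
    HasFDerivAt logSumExp
      (∑ k, softmax z k • (ContinuousLinearMap.proj k : (K → ℝ) →L[ℝ] ℝ)) z := by
  have h1 : HasFDerivAt (fun z : K → ℝ => ∑ k, Real.exp (z k))
      (∑ k, Real.exp (z k) • (ContinuousLinearMap.proj k : (K → ℝ) →L[ℝ] ℝ)) z :=
    HasFDerivAt.fun_sum fun k _ => (hasFDerivAt_apply k z).exp
  refine (h1.log (sum_exp_pos z).ne').congr_fderiv ?_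
  rw [Finset.smul_sum]
  refine Finset.sum_congr rfl fun k _ => ?_
  rw [smul_smul, softmax]
  congr 1
  field_simp

lemma softmax_eq_exp_sub_logSumExp [Nonempty K] (z : K → ℝ) (k : K) :
    softmax z k = Real.exp (z k - logSumExp z) := by
  rw [Real.exp_sub, logSumExp, Real.exp_log (sum_exp_pos z), softmax]

lemma hasFDerivAt_softmax [Nonempty K] (z : K → ℝ) (k : K) :
    HasFDerivAt (fun z => softmax z k)
      (softmax z k • ((ContinuousLinearMap.proj k : (K → ℝ) →L[ℝ] ℝ)
        - ∑ l, softmax z l • (ContinuousLinearMap.proj l : (K → ℝ) →L[ℝ] ℝ))) z := by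
  simp_rw [softmax_eq_exp_sub_logSumExp _ k]
  exact ((hasFDerivAt_apply (𝕜 := ℝ) k z).sub (hasFDerivAt_logSumExp z)).exp

lemma continuous_logSumExp [Nonempty K] : Continuous (logSumExp : (K → ℝ) → ℝ) :=
  continuous_iff_continuousAt.2 fun z => (hasFDerivAt_logSumExp z).continuousAt

lemma continuous_softmax [Nonempty K] (k : K) : Continuous fun z : K → ℝ => softmax z k :=
  continuous_iff_continuousAt.2 fun z => (hasFDerivAt_softmax z k).continuousAt

end LogSumExp

section SudakovFernique

lemma sum_mul_diag_sub_sum_nonneg {K : Type*} [Fintype K] {p : K → ℝ} (hp : ∀ k, 0 ≤ p k)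
    (hp1 : ∑ k, p k = 1) {D : K → K → ℝ} (hD : ∀ k l, D k l + D l k ≤ D k k + D l l) :
    0 ≤ ∑ k, p k * (D k k - ∑ l, p l * D l k) := by
  have hnonneg : 0 ≤ ∑ k, ∑ l, p k * p l * (D k k + D l l - (D k l + D l k)) :=
    Finset.sum_nonneg fun k _ => Finset.sum_nonneg fun l _ =>
      mul_nonneg (mul_nonneg (hp k) (hp l)) (by linarith [hD k l])
  have hdiag : ∑ k, ∑ l, p k * p l * D k k = ∑ k, p k * D k k := by
    simp_rw [mul_right_comm (p _) (p _), ← Finset.mul_sum, hp1, mul_one]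
  have hdiag' : ∑ k, ∑ l, p k * p l * D l l = ∑ k, p k * D k k := by
    rw [← hdiag, Finset.sum_comm]
    simp_rw [mul_comm (p _) (p _)]
  have hcross : ∑ k, ∑ l, p k * p l * D k l = ∑ k, ∑ l, p k * p l * D l k := by
    rw [Finset.sum_comm]
    simp_rw [mul_comm (p _) (p _)]
  simp_rw [mul_sub, mul_add, Finset.sum_sub_distrib, Finset.sum_add_distrib, hdiag, hdiag',
    hcross] at hnonneg
  simp_rw [mul_sub, Finset.mul_sum, ← mul_assoc, Finset.sum_sub_distrib]
  linarith

variable {K : Type*} {W : Type*} [NormedAddCommGroup W] [NormedSpace ℝ W]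

lemma hasFDerivAt_affine_family (V : K → StrongDual ℝ W) (c : K → ℝ) (w : W) :
    HasFDerivAt (fun w k => V k w + c k) (ContinuousLinearMap.pi V) w :=
  hasFDerivAt_pi.2 fun k => (V k).hasFDerivAt.add_const _

variable [Fintype K] [Nonempty K]

lemma norm_softmax_smul_le {M : Type*} [NormedAddCommGroup M] [NormedSpace ℝ M] (z : K → ℝ)
    (k : K) (v : M) : ‖softmax z k • v‖ ≤ ‖v‖ := by
  rw [norm_smul, Real.norm_of_nonneg (softmax_nonneg _ _)]
  exact mul_le_of_le_one_left (norm_nonneg _) (softmax_le_one _ _)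

lemma hasFDerivAt_logSumExp_dual (V : K → StrongDual ℝ W) (c : K → ℝ) (w : W) :
    HasFDerivAt (fun w => logSumExp fun k => V k w + c k)
      (∑ k, softmax (fun k => V k w + c k) k • V k) w := by
  refine ((hasFDerivAt_logSumExp _).comp w (hasFDerivAt_affine_family V c w)).congr_fderiv ?_
  ext v
  simp

lemma hasFDerivAt_softmax_dual (V : K → StrongDual ℝ W) (c : K → ℝ) (k : K) (w : W) :
    HasFDerivAt (fun w => softmax (fun k => V k w + c k) k)
      (softmax (fun k => V k w + c k) k
        • (V k - ∑ l, softmax (fun k => V k w + c k) l • V l)) w := by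
  refine ((hasFDerivAt_softmax _ k).comp w (hasFDerivAt_affine_family V c w)).congr_fderiv ?_
  ext v
  simp

@[fun_prop]
lemma continuous_softmax_dual (V : K → StrongDual ℝ W) (c : K → ℝ) (k : K) :
    Continuous fun w => softmax (fun k => V k w + c k) k :=
  (continuous_softmax k).comp (by fun_prop : Continuous fun w k => V k w + c k)

variable [MeasurableSpace W] [BorelSpace W] {μ : Measure W}

lemma integrable_softmax_mul (V : K → StrongDual ℝ W) (c : K → ℝ) (k : K) {g : W → ℝ}
    (hg : Integrable g μ) : Integrable (fun w => softmax (fun k => V k w + c k) k * g w) μ :=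
  hg.bdd_mul (c := 1) (continuous_softmax_dual V c k).aestronglyMeasurable
    (Eventually.of_forall fun _ => by
      rw [Real.norm_of_nonneg (softmax_nonneg _ _)]; exact softmax_le_one _ _)

variable [IsGaussian μ]

lemma integrable_logSumExp_dual (V : K → StrongDual ℝ W) (c : K → ℝ) :
    Integrable (fun w => logSumExp fun k => V k w + c k) μ :=
  ((integrable_finsetSum _ fun k _ =>
    ((IsGaussian.integrable_dual μ (V k)).add (integrable_const (c k))).abs).add
      (integrable_const _)).mono' (continuous_logSumExp.comp (by fun_prop)).aestronglyMeasurable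
    (Eventually.of_forall fun _ => abs_logSumExp_le _)

variable [SecondCountableTopology W] [CompleteSpace W]

lemma integral_softmax_mul_dual (hμ : μ[id] = 0) (V : K → StrongDual ℝ W) (c : K → ℝ) (k : K)
    (L : StrongDual ℝ W) :
    ∫ w, softmax (fun k => V k w + c k) k * L w ∂μ
      = ∫ w, softmax (fun k => V k w + c k) k * (covarianceBilinDual μ (V k) L
          - ∑ l, softmax (fun k => V k w + c k) l * covarianceBilinDual μ (V l) L) ∂μ := by
  have hV : 0 ≤ ∑ l, ‖V l‖ := Finset.sum_nonneg fun _ _ => norm_nonneg _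
  rw [integral_mul_dual_eq_integral_covarianceBilinDual hμ (C := 1 + ‖V k‖ + ∑ l, ‖V l‖)
    (hasFDerivAt_softmax_dual V c k) (by fun_prop) (fun w => ?_) (fun w => ?_) L]
  · simp [_root_.sum_apply]
  · rw [abs_of_nonneg (softmax_nonneg _ _)]
    linarith [softmax_le_one (fun k => V k w + c k) k, norm_nonneg (V k)]
  · have hsum : ‖∑ l, softmax (fun k => V k w + c k) l • V l‖ ≤ ∑ l, ‖V l‖ :=
      norm_sum_le_of_le _ fun l _ => norm_softmax_smul_le _ l (V l)
    refine (norm_softmax_smul_le (M := StrongDual ℝ W) _ k _).trans ?_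
    linarith [norm_sub_le (V k) (∑ l, softmax (fun k => V k w + c k) l • V l)]

lemma integral_sum_softmax_mul_dual_nonneg (hμ : μ[id] = 0) (V U : K → StrongDual ℝ W) (c : K → ℝ)
    (hVU : ∀ k l, 0 ≤ covarianceBilinDual μ (V k - V l) (U k - U l)) :
    0 ≤ ∫ w, ∑ k, softmax (fun k => V k w + c k) k * U k w ∂μ := by
  rw [integral_finsetSum _ fun k _ =>
    integrable_softmax_mul V c k (IsGaussian.integrable_dual μ (U k))]
  simp_rw [integral_softmax_mul_dual hμ]
  have hint : ∀ k, Integrable (fun w => softmax (fun k => V k w + c k) k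
      * (covarianceBilinDual μ (V k) (U k) - ∑ l, softmax (fun k => V k w + c k) l
        * covarianceBilinDual μ (V l) (U k))) μ := fun k =>
    integrable_softmax_mul V c k ((integrable_const _).sub
      (integrable_finsetSum _ fun l _ => integrable_softmax_mul V c l (integrable_const _)))
  rw [← integral_finsetSum _ fun k _ => hint k]
  refine integral_nonneg fun w => sum_mul_diag_sub_sum_nonneg (softmax_nonneg _) (sum_softmax _)
    (D := fun l k => covarianceBilinDual μ (V l) (U k)) fun k l => ?_
  have h := hVU k l
  simp only [map_sub, _root_.sub_apply] at h
  linarith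

lemma hasDerivAt_integral_logSumExp_rotation (A B : K → StrongDual ℝ W) (c : K → ℝ) (θ : ℝ) :
    HasDerivAt
      (fun θ => ∫ w, logSumExp
        (fun k => (ContinuousLinearMap.rotation θ (A, B)).1 k w + c k) ∂μ)
      (∫ w, ∑ k, softmax (fun k => (ContinuousLinearMap.rotation θ (A, B)).1 k w + c k) k
        * (ContinuousLinearMap.rotation θ (A, B)).2 k w ∂μ) θ := by
  refine (hasDerivAt_integral_of_dominated_loc_of_deriv_le (s := Set.univ)
    (bound := fun w => ∑ _k : K, (‖A‖ + ‖B‖) * ‖w‖)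
    (F' := fun θ w => ∑ k, softmax (fun k => (ContinuousLinearMap.rotation θ (A, B)).1 k w + c k) k
        * (ContinuousLinearMap.rotation θ (A, B)).2 k w) univ_mem
    (Eventually.of_forall fun θ => (integrable_logSumExp_dual _ c).1)
    (integrable_logSumExp_dual _ c) (by fun_prop)
    (Eventually.of_forall fun w θ _ => norm_sum_le_of_le _ fun k _ => ?_)
    (integrable_finsetSum _ fun _ _ => IsGaussian.integrable_id.norm.const_mul _)
    (Eventually.of_forall fun w θ _ => ?_)).2
  · refine (norm_softmax_smul_le _ _ _).trans
      (((ContinuousLinearMap.rotation θ (A, B)).2 k).le_of_opNorm_le ?_ w)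
    exact (norm_le_pi_norm _ k).trans ((norm_snd_le _).trans (norm_rotation_le θ (A, B)))
  · have hfam : HasDerivAt (fun θ k => (ContinuousLinearMap.rotation θ (A, B)).1 k w + c k)
        (fun k => (ContinuousLinearMap.rotation θ (A, B)).2 k w) θ := by
      refine hasDerivAt_pi.2 fun k => ?_
      refine (((hasDerivAt_pi.1 (hasDerivAt_rotation θ (A, B)).fst k).clm_apply
        (hasDerivAt_const θ w)).add_const (c k)).congr_deriv ?_
      simp
    refine ((hasFDerivAt_logSumExp _).comp_hasDerivAt θ hfam).congr_deriv ?_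
    simp

theorem integral_logSumExp_le_of_covarianceBilinDual_sub_le (hμ : μ[id] = 0)
    (A B : K → StrongDual ℝ W) (c : K → ℝ) (hAB : ∀ k l, covarianceBilinDual μ (A k) (B l) = 0)
    (hle : ∀ k l, covarianceBilinDual μ (A k - A l) (A k - A l)
      ≤ covarianceBilinDual μ (B k - B l) (B k - B l)) :
    ∫ w, logSumExp (fun k => A k w + c k) ∂μ ≤ ∫ w, logSumExp (fun k => B k w + c k) ∂μ := by
  have hBA : ∀ k l, covarianceBilinDual μ (B k) (A l) = 0 := fun k l => by
    rw [covarianceBilinDual_comm, hAB]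
  let Φ : ℝ → ℝ := fun θ => ∫ w, logSumExp
    (fun k => (ContinuousLinearMap.rotation θ (A, B)).1 k w + c k) ∂μ
  have hΦ : ∀ θ, HasDerivAt Φ _ θ := hasDerivAt_integral_logSumExp_rotation A B c
  have hcov : ∀ θ k l, covarianceBilinDual μ
      ((ContinuousLinearMap.rotation θ (A, B)).1 k - (ContinuousLinearMap.rotation θ (A, B)).1 l)
      ((ContinuousLinearMap.rotation θ (A, B)).2 k - (ContinuousLinearMap.rotation θ (A, B)).2 l)
      = Real.sin θ * Real.cos θ * (covarianceBilinDual μ (B k - B l) (B k - B l)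
        - covarianceBilinDual μ (A k - A l) (A k - A l)) := by
    intro θ k l
    simp only [ContinuousLinearMap.rotation_apply, Pi.add_apply, Pi.smul_apply, map_add, map_sub,
      map_smul, _root_.add_apply, _root_.sub_apply, _root_.smul_apply, smul_eq_mul, hAB, hBA]
    ring
  have hmono : MonotoneOn Φ (Set.Icc 0 (Real.pi / 2)) := by
    refine monotoneOn_of_deriv_nonneg (convex_Icc _ _)
      (fun θ _ => (hΦ θ).continuousAt.continuousWithinAt)
      (fun θ _ => (hΦ θ).differentiableAt.differentiableWithinAt) fun θ hθ => ?_
    have hθ' := interior_subset hθ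
    rw [(hΦ θ).deriv]
    refine integral_sum_softmax_mul_dual_nonneg hμ _ _ c fun k l => ?_
    rw [hcov]
    exact mul_nonneg (mul_nonneg
      (Real.sin_nonneg_of_nonneg_of_le_pi hθ'.1 (by linarith [hθ'.2, pi_pos]))
      (Real.cos_nonneg_of_neg_pi_div_two_le_of_le (by linarith [hθ'.1, pi_pos]) hθ'.2))
      (sub_nonneg.2 (hle k l))
  have hpi : (0 : ℝ) ≤ Real.pi / 2 := div_nonneg pi_pos.le zero_le_two
  simpa [Φ, ContinuousLinearMap.rotation_apply] using
    hmono (Set.left_mem_Icc.2 hpi) (Set.right_mem_Icc.2 hpi) hpi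

end SudakovFernique

section StdGaussian

variable {E F : Type*} [NormedAddCommGroup E] [InnerProductSpace ℝ E] [FiniteDimensional ℝ E]
  [MeasurableSpace E] [BorelSpace E] [NormedAddCommGroup F] [InnerProductSpace ℝ F]
  [FiniteDimensional ℝ F] [MeasurableSpace F] [BorelSpace F]

lemma covarianceBilinDual_stdGaussian_innerSL (x y : E) :
    covarianceBilinDual (stdGaussian E) (innerSL ℝ x) (innerSL ℝ y) = inner ℝ x y := by
  have h := DFunLike.congr_fun (DFunLike.congr_fun (covarianceBilin_stdGaussian (E := E)) x) y
  rwa [innerSL_apply_apply] at h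

lemma integral_inner_sq_stdGaussian (a : E) :
    ∫ w, inner ℝ a w ^ 2 ∂(stdGaussian E) = ‖a‖ ^ 2 := by
  have h := variance_dual_stdGaussian (innerSL ℝ a)
  rw [variance_of_integral_eq_zero (by fun_prop) (integral_strongDual_stdGaussian _)] at h
  simpa using h

lemma integral_norm_sq_stdGaussian :
    ∫ w : E, ‖w‖ ^ 2 ∂(stdGaussian E) = Module.finrank ℝ E := by
  let e := stdOrthonormalBasis ℝ E
  have hint : ∀ i ∈ Finset.univ, Integrable (fun w => inner ℝ (e i) w ^ 2) (stdGaussian E) :=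
    fun i _ => (IsGaussian.memLp_dual (stdGaussian E) (innerSL ℝ (e i)) 2 (by simp)).integrable_sq
  simp_rw [← e.sum_sq_inner_right]
  rw [integral_finsetSum _ hint]
  simp_rw [integral_inner_sq_stdGaussian, e.norm_eq_one]
  simp

lemma integral_norm_stdGaussian_le :
    ∫ w : E, ‖w‖ ∂(stdGaussian E) ≤ √(Module.finrank ℝ E) := by
  have hmem : MemLp (fun w : E => ‖w‖) 2 (stdGaussian E) := IsGaussian.memLp_two_id.norm
  have h := variance_nonneg (fun w : E => ‖w‖) (stdGaussian E)
  rw [variance_eq_sub hmem, sub_nonneg] at h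
  exact Real.le_sqrt_of_sq_le (h.trans_eq integral_norm_sq_stdGaussian)

lemma eLpNorm_dual_stdGaussian (L : StrongDual ℝ E) (r : ℝ≥0∞) :
    eLpNorm L r (stdGaussian E) = ‖L‖ₑ * eLpNorm id r (gaussianReal 0 1) := by
  have hmap : (stdGaussian E).map L = (gaussianReal 0 1).map (fun t => ‖L‖ * t) := by
    rw [IsGaussian.map_eq_gaussianReal, variance_dual_stdGaussian,
      integral_strongDual_stdGaussian, gaussianReal_map_const_mul]
    congr 1
    · simp
    · ext; simp
  calc eLpNorm L r (stdGaussian E) = eLpNorm id r ((stdGaussian E).map L) := by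
        rw [eLpNorm_map_measure aestronglyMeasurable_id L.continuous.aemeasurable]; rfl
    _ = eLpNorm (‖L‖ • (id : ℝ → ℝ)) r (gaussianReal 0 1) := by
        rw [hmap, eLpNorm_map_measure aestronglyMeasurable_id (by fun_prop)]; rfl
    _ = ‖L‖ₑ * eLpNorm id r (gaussianReal 0 1) := by rw [eLpNorm_const_smul, enorm_norm]

lemma stdGaussian_map_of_inner_eq {f : E → F} {g : F → E} (hf : Measurable f)
    (hfg : ∀ w t, inner ℝ (f w) t = inner ℝ w (g t)) (hg : ∀ t, ‖g t‖ = ‖t‖) :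
    (stdGaussian E).map f = stdGaussian F := by
  have : IsProbabilityMeasure ((stdGaussian E).map f) :=
    Measure.isProbabilityMeasure_map hf.aemeasurable
  refine Measure.ext_of_charFun ?_
  ext t
  rw [charFun_apply, integral_map hf.aemeasurable (by fun_prop), charFun_stdGaussian, ← hg t,
    ← charFun_stdGaussian, charFun_apply]
  simp_rw [hfg]

lemma measurePreserving_fst_stdGaussian : MeasurePreserving
    (fun z : WithLp 2 (E × F) => z.fst) (stdGaussian (WithLp 2 (E × F))) (stdGaussian E) :=
  have hm := (WithLp.fstL 2 ℝ E F).continuous.measurable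
  ⟨hm, stdGaussian_map_of_inner_eq (g := fun t => WithLp.toLp 2 (t, (0 : F))) hm
    (fun w t => by simp) (fun t => by simp)⟩

lemma measurePreserving_snd_stdGaussian : MeasurePreserving
    (fun z : WithLp 2 (E × F) => z.snd) (stdGaussian (WithLp 2 (E × F))) (stdGaussian F) :=
  have hm := (WithLp.sndL 2 ℝ E F).continuous.measurable
  ⟨hm, stdGaussian_map_of_inner_eq (g := fun t => WithLp.toLp 2 ((0 : E), t)) hm
    (fun w t => by simp) (fun t => by simp)⟩

variable {K : Type*} [Fintype K] [Nonempty K]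

lemma integral_logSumExp_inner_le (a : K → E) (b : K → F) (c : K → ℝ)
    (hab : ∀ k l, ‖a k - a l‖ ≤ ‖b k - b l‖) :
    ∫ w, logSumExp (fun k => inner ℝ (a k) w + c k) ∂(stdGaussian E)
      ≤ ∫ w, logSumExp (fun k => inner ℝ (b k) w + c k) ∂(stdGaussian F) := by
  let A : K → WithLp 2 (E × F) := fun k => WithLp.toLp 2 (a k, 0)
  let B : K → WithLp 2 (E × F) := fun k => WithLp.toLp 2 (0, b k)
  have hcomp := integral_logSumExp_le_of_covarianceBilinDual_sub_le
    (μ := stdGaussian (WithLp 2 (E × F))) integral_id_stdGaussian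
    (fun k => innerSL ℝ (A k)) (fun k => innerSL ℝ (B k)) c
    (fun k l => by simp [covarianceBilinDual_stdGaussian_innerSL, A, B]) (fun k l => by
      simp_rw [← map_sub, covarianceBilinDual_stdGaussian_innerSL, A, B, ← WithLp.toLp_sub]
      simpa using pow_le_pow_left₀ (norm_nonneg _) (hab k l) 2)
  have hcontE : Continuous fun w => logSumExp fun k => inner ℝ (a k) w + c k :=
    continuous_logSumExp.comp (by fun_prop)
  have hcontF : Continuous fun w => logSumExp fun k => inner ℝ (b k) w + c k :=
    continuous_logSumExp.comp (by fun_prop)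
  rw [← (measurePreserving_fst_stdGaussian (E := E) (F := F)).map_eq,
    ← (measurePreserving_snd_stdGaussian (E := E) (F := F)).map_eq,
    integral_map measurePreserving_fst_stdGaussian.aemeasurable hcontE.aestronglyMeasurable,
    integral_map measurePreserving_snd_stdGaussian.aemeasurable hcontF.aestronglyMeasurable]
  simpa [A, B] using hcomp

lemma eLpNorm_logSumExp_inner_sub_le (a : K → E) (c : K → ℝ) {R : ℝ} (ha : ∀ k, ‖a k‖ ≤ R)
    {r : ℝ≥0} (hr : 1 ≤ r) :
    eLpNorm (fun q : E × E => logSumExp (fun k => inner ℝ (a k) q.2 + c k)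
        - logSumExp (fun k => inner ℝ (a k) q.1 + c k)) r ((stdGaussian E).prod (stdGaussian E))
      ≤ ENNReal.ofReal (Real.pi / 2) * (ENNReal.ofReal R * eLpNorm id r (gaussianReal 0 1)) := by
  refine eLpNorm_sub_le_of_eLpNorm_fderiv_le integral_id_stdGaussian
    (hasFDerivAt_logSumExp_dual (fun k => innerSL ℝ (a k)) c) (by fun_prop) hr fun w => ?_
  rw [eLpNorm_dual_stdGaussian, ← ofReal_norm]
  gcongr
  calc ‖∑ k, softmax (fun k => innerSL ℝ (a k) w + c k) k • innerSL ℝ (a k)‖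
      ≤ ∑ k, softmax (fun k => innerSL ℝ (a k) w + c k) k * R :=
        norm_sum_le_of_le _ fun k _ => by
          rw [norm_smul, innerSL_apply_norm, Real.norm_of_nonneg (softmax_nonneg _ _)]
          exact mul_le_mul_of_nonneg_left (ha k) (softmax_nonneg _ _)
    _ = R := by rw [← Finset.sum_mul, sum_softmax, one_mul]

end StdGaussian

section SmoothMax

/-- The smooth approximation at inverse temperature `N + 1` of the maximum of the first `N + 1`
terms of a sequence. -/
noncomputable def smoothMax (z : ℕ → ℝ) (N : ℕ) : ℝ :=
  ((N : ℝ) + 1)⁻¹ * logSumExp fun k : Fin (N + 1) => ((N : ℝ) + 1) * z k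

lemma le_smoothMax (z : ℕ → ℝ) {k N : ℕ} (h : k ≤ N) : z k ≤ smoothMax z N := by
  have hN : (0 : ℝ) < (N : ℝ) + 1 := by positivity
  rw [smoothMax, ← div_eq_inv_mul, le_div_iff₀ hN, mul_comm]
  exact le_logSumExp (fun k : Fin (N + 1) => ((N : ℝ) + 1) * z k) ⟨k, Nat.lt_succ_of_le h⟩

lemma smoothMax_le {z : ℕ → ℝ} {M : ℝ} (h : ∀ k, z k ≤ M) (N : ℕ) :
    smoothMax z N ≤ M + Real.log ((N : ℝ) + 1) / ((N : ℝ) + 1) := by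
  have hN : (0 : ℝ) < (N : ℝ) + 1 := by positivity
  have hle := logSumExp_le (fun k : Fin (N + 1) => ((N : ℝ) + 1) * z k) (M := ((N : ℝ) + 1) * M)
    fun k => mul_le_mul_of_nonneg_left (h k) hN.le
  rw [smoothMax, ← div_eq_inv_mul, div_le_iff₀ hN, add_mul, div_mul_cancel₀ _ hN.ne', mul_comm M]
  simpa using hle

lemma abs_smoothMax_le {z : ℕ → ℝ} {M : ℝ} (h : ∀ k, |z k| ≤ M) (N : ℕ) :
    |smoothMax z N| ≤ M + 1 := by
  have hN : (0 : ℝ) < (N : ℝ) + 1 := by positivity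
  have hlog : Real.log ((N : ℝ) + 1) / ((N : ℝ) + 1) ≤ 1 :=
    (div_le_one hN).2 (Real.log_le_self hN.le)
  rw [abs_le]
  constructor
  · linarith [le_smoothMax z (Nat.zero_le N), (abs_le.1 (h 0)).1]
  · linarith [smoothMax_le (fun k => (abs_le.1 (h k)).2) N]

lemma tendsto_smoothMax {z : ℕ → ℝ} (hz : BddAbove (Set.range z)) :
    Tendsto (smoothMax z) atTop (𝓝 (⨆ k, z k)) := by
  have hlog : Tendsto (fun N : ℕ => Real.log ((N : ℝ) + 1) / ((N : ℝ) + 1)) atTop (𝓝 0) :=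
    Real.isLittleO_log_id_atTop.tendsto_div_nhds_zero.comp
      (tendsto_atTop_add_const_right _ _ tendsto_natCast_atTop_atTop)
  refine tendsto_order.2 ⟨fun r hr => ?_, fun r hr => ?_⟩
  · obtain ⟨k, hk⟩ := exists_lt_of_lt_ciSup hr
    filter_upwards [eventually_ge_atTop k] with N hN
    exact hk.trans_le (le_smoothMax z hN)
  · filter_upwards [hlog.eventually_lt_const (sub_pos.2 hr)] with N hN
    linarith [smoothMax_le (fun k => le_ciSup hz k) N]

end SmoothMax

section SupAffine

open TopologicalSpace (SeparableSpace denseSeq denseRange_denseSeq)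

variable {ι : Type*} {E F : Type*} [NormedAddCommGroup E] [InnerProductSpace ℝ E]
  [NormedAddCommGroup F] [InnerProductSpace ℝ F]

/-- The supremum of a family of affine functions on an inner product space. -/
noncomputable def supAffine (a : ι → E) (c : ι → ℝ) (w : E) : ℝ := ⨆ i, (inner ℝ (a i) w + c i)

lemma smoothMax_affine_eq (u : ℕ → E) (d : ℕ → ℝ) (N : ℕ) (w : E) :
    smoothMax (fun k => inner ℝ (u k) w + d k) N = ((N : ℝ) + 1)⁻¹ *
      logSumExp fun k : Fin (N + 1) => inner ℝ (((N : ℝ) + 1) • u k) w + ((N : ℝ) + 1) * d k := by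
  simp only [smoothMax, mul_add, real_inner_smul_left]

lemma measurable_smoothMax_affine [MeasurableSpace E] [BorelSpace E] (u : ℕ → E)
    (d : ℕ → ℝ) (N : ℕ) :
    Measurable fun w => smoothMax (fun k => inner ℝ (u k) w + d k) N :=
  (continuous_const.mul (continuous_logSumExp.comp (by fun_prop))).measurable

lemma eLpNorm_smoothMax_affine_sub_le [FiniteDimensional ℝ E] [MeasurableSpace E] [BorelSpace E]
    {u : ℕ → E} (d : ℕ → ℝ) {R : ℝ} (hu : ∀ k, ‖u k‖ ≤ R) (N : ℕ) {r : ℝ≥0} (hr : 1 ≤ r) :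
    eLpNorm (fun q : E × E => smoothMax (fun k => inner ℝ (u k) q.2 + d k) N
        - smoothMax (fun k => inner ℝ (u k) q.1 + d k) N) r ((stdGaussian E).prod (stdGaussian E))
      ≤ ENNReal.ofReal (Real.pi / 2) * (ENNReal.ofReal R * eLpNorm id r (gaussianReal 0 1)) := by
  have hN : (0 : ℝ) < (N : ℝ) + 1 := by positivity
  have hle := eLpNorm_logSumExp_inner_sub_le (fun k : Fin (N + 1) => ((N : ℝ) + 1) • u k)
    (fun k => ((N : ℝ) + 1) * d k) (R := ((N : ℝ) + 1) * R) (fun k => by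
      rw [norm_smul, Real.norm_of_nonneg hN.le]
      exact mul_le_mul_of_nonneg_left (hu _) hN.le) hr
  simp_rw [smoothMax_affine_eq, ← mul_sub]
  refine (eLpNorm_const_smul (((N : ℝ) + 1)⁻¹) (fun q : E × E =>
    logSumExp (fun k : Fin (N + 1) => inner ℝ (((N : ℝ) + 1) • u k) q.2 + ((N : ℝ) + 1) * d k)
      - logSumExp (fun k : Fin (N + 1) => inner ℝ (((N : ℝ) + 1) • u k) q.1
        + ((N : ℝ) + 1) * d k)) _ _).trans_le ?_
  rw [Real.enorm_of_nonneg (inv_nonneg.2 hN.le)]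
  calc ENNReal.ofReal ((N : ℝ) + 1)⁻¹ * _
      ≤ ENNReal.ofReal ((N : ℝ) + 1)⁻¹ * (ENNReal.ofReal (Real.pi / 2)
        * (ENNReal.ofReal (((N : ℝ) + 1) * R) * eLpNorm id r (gaussianReal 0 1))) := by gcongr
    _ = _ := by
        rw [ENNReal.ofReal_mul hN.le, mul_assoc (ENNReal.ofReal _), mul_left_comm,
          ← mul_assoc (ENNReal.ofReal _⁻¹), ← ENNReal.ofReal_mul (inv_nonneg.2 hN.le),
          inv_mul_cancel₀ hN.ne', ENNReal.ofReal_one, one_mul]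

variable [TopologicalSpace ι] [CompactSpace ι] {a : ι → E} {b : ι → F} {c : ι → ℝ}

lemma bddAbove_affine (ha : Continuous a) (hc : Continuous c) (w : E) :
    BddAbove (Set.range fun i => inner ℝ (a i) w + c i) :=
  (isCompact_range (by fun_prop)).bddAbove

lemma exists_abs_affine_le (ha : Continuous a) (hc : Continuous c) :
    ∃ R C : ℝ, ∀ i w, |inner ℝ (a i) w + c i| ≤ R * ‖w‖ + C := by
  obtain ⟨R, hR⟩ := (isCompact_range ha.norm).bddAbove
  obtain ⟨C, hC⟩ := (isCompact_range hc.abs).bddAbove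
  refine ⟨R, C, fun i w => (abs_add_le _ _).trans (add_le_add ?_ (hC ⟨i, rfl⟩))⟩
  exact (abs_real_inner_le_norm _ _).trans
    (mul_le_mul_of_nonneg_right (hR ⟨i, rfl⟩) (norm_nonneg _))

variable [Nonempty ι]

lemma exists_supAffine_eq (ha : Continuous a) (hc : Continuous c) (w : E) :
    ∃ i, supAffine a c w = inner ℝ (a i) w + c i := by
  obtain ⟨i, -, hi⟩ := isCompact_univ.exists_isMaxOn Set.univ_nonempty
    (f := fun i => inner ℝ (a i) w + c i) (by fun_prop)
  exact ⟨i, le_antisymm (ciSup_le fun j => hi (Set.mem_univ j))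
    (le_ciSup (bddAbove_affine ha hc w) i)⟩

variable [SeparableSpace ι]

lemma supAffine_eq_iSup_denseSeq (ha : Continuous a) (hc : Continuous c) (w : E) :
    supAffine a c w = ⨆ k, (inner ℝ (a (denseSeq ι k)) w + c (denseSeq ι k)) := by
  have hbdd := bddAbove_affine ha hc w
  have hbdd' : BddAbove (Set.range fun k => inner ℝ (a (denseSeq ι k)) w + c (denseSeq ι k)) :=
    hbdd.mono (Set.range_comp_subset_range (denseSeq ι) fun i => inner ℝ (a i) w + c i)
  refine le_antisymm (ciSup_le fun i => ?_) (ciSup_le fun k => le_ciSup hbdd _)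
  exact (denseRange_denseSeq ι).induction_on i
    (isClosed_le (by fun_prop) continuous_const) fun k => le_ciSup hbdd' k

lemma tendsto_smoothMax_affine (ha : Continuous a) (hc : Continuous c) (w : E) :
    Tendsto (smoothMax fun k => inner ℝ (a (denseSeq ι k)) w + c (denseSeq ι k)) atTop
      (𝓝 (supAffine a c w)) := by
  rw [supAffine_eq_iSup_denseSeq ha hc]
  exact tendsto_smoothMax ((bddAbove_affine ha hc w).mono
    (Set.range_comp_subset_range (denseSeq ι) fun i => inner ℝ (a i) w + c i))

variable [FiniteDimensional ℝ E] [MeasurableSpace E] [BorelSpace E]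

lemma tendsto_integral_smoothMax_affine (ha : Continuous a) (hc : Continuous c) :
    Tendsto (fun N => ∫ w, smoothMax
        (fun k => inner ℝ (a (denseSeq ι k)) w + c (denseSeq ι k)) N ∂(stdGaussian E)) atTop
      (𝓝 (∫ w, supAffine a c w ∂(stdGaussian E))) := by
  obtain ⟨R, C, hRC⟩ := exists_abs_affine_le ha hc
  have hint : Integrable (fun w : E => R * ‖w‖ + C + 1) (stdGaussian E) :=
    ((IsGaussian.integrable_id.norm.const_mul _).add (integrable_const _)).add (integrable_const _)
  exact tendsto_integral_of_dominated_convergence _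
    (fun N => (measurable_smoothMax_affine _ _ N).aestronglyMeasurable) hint
    (fun N => Eventually.of_forall fun w => abs_smoothMax_le (fun k => hRC _ w) N)
    (Eventually.of_forall fun w => tendsto_smoothMax_affine ha hc w)

lemma integrable_supAffine (ha : Continuous a) (hc : Continuous c) :
    Integrable (supAffine a c) (stdGaussian E) := by
  obtain ⟨R, C, hRC⟩ := exists_abs_affine_le ha hc
  have hint : Integrable (fun w : E => R * ‖w‖ + C) (stdGaussian E) :=
    (IsGaussian.integrable_id.norm.const_mul _).add (integrable_const _)
  have hm : Measurable (supAffine a c) := measurable_of_tendsto_metrizable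
    (fun N => measurable_smoothMax_affine _ _ N)
    (tendsto_pi_nhds.2 fun w => tendsto_smoothMax_affine ha hc w)
  refine hint.mono' hm.aestronglyMeasurable (Eventually.of_forall fun w => ?_)
  obtain ⟨i⟩ := ‹Nonempty ι›
  exact abs_le.2 ⟨(abs_le.1 (hRC i w)).1.trans (le_ciSup (bddAbove_affine ha hc w) i),
    ciSup_le fun i => (abs_le.1 (hRC i w)).2⟩

/-- **Sudakov–Fernique inequality**. -/
theorem integral_supAffine_le_of_norm_sub_le [FiniteDimensional ℝ F] [MeasurableSpace F]
    [BorelSpace F] (ha : Continuous a) (hb : Continuous b) (hc : Continuous c)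
    (hab : ∀ i j, ‖a i - a j‖ ≤ ‖b i - b j‖) :
    ∫ w, supAffine a c w ∂(stdGaussian E) ≤ ∫ w, supAffine b c w ∂(stdGaussian F) := by
  refine le_of_tendsto_of_tendsto' (tendsto_integral_smoothMax_affine ha hc)
    (tendsto_integral_smoothMax_affine hb hc) fun N => ?_
  simp_rw [smoothMax_affine_eq, integral_const_mul]
  refine mul_le_mul_of_nonneg_left (integral_logSumExp_inner_le _ _ _ fun k l => ?_) (by positivity)
  rw [← smul_sub, ← smul_sub, norm_smul, norm_smul]
  exact mul_le_mul_of_nonneg_left (hab _ _) (norm_nonneg _)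

lemma integral_supAffine_le_of_norm_le (ha : Continuous a) (hc : Continuous c) {R : ℝ}
    (hR : ∀ i, ‖a i‖ ≤ R) (hc₀ : ∀ i, c i ≤ 0) :
    ∫ w, supAffine a c w ∂(stdGaussian E) ≤ R * √(Module.finrank ℝ E) := by
  have hR₀ : 0 ≤ R := (norm_nonneg _).trans (hR (Classical.arbitrary ι))
  calc ∫ w, supAffine a c w ∂(stdGaussian E)
      ≤ ∫ w, R * ‖w‖ ∂(stdGaussian E) := by
        refine integral_mono (integrable_supAffine ha hc)
          (IsGaussian.integrable_id.norm.const_mul _) fun w => ciSup_le fun i => ?_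
        have hinner : inner ℝ (a i) w ≤ R * ‖w‖ := (real_inner_le_norm _ _).trans
          (mul_le_mul_of_nonneg_right (hR i) (norm_nonneg w))
        linarith [hc₀ i]
    _ = R * ∫ w, ‖w‖ ∂(stdGaussian E) := integral_const_mul _ _
    _ ≤ R * √(Module.finrank ℝ E) := mul_le_mul_of_nonneg_left integral_norm_stdGaussian_le hR₀

theorem eLpNorm_supAffine_sub_integral_le (ha : Continuous a) (hc : Continuous c) {R : ℝ}
    (hR : ∀ i, ‖a i‖ ≤ R) {r : ℝ≥0} (hr : 1 ≤ r) :
    eLpNorm (fun w => supAffine a c w - ∫ v, supAffine a c v ∂(stdGaussian E)) r (stdGaussian E)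
      ≤ ENNReal.ofReal (Real.pi / 2) * (ENNReal.ofReal R * eLpNorm id r (gaussianReal 0 1)) := by
  let f : ℕ → E → ℝ := fun N w => smoothMax
    (fun k => inner ℝ (a (denseSeq ι k)) w + c (denseSeq ι k)) N
  have hfm : ∀ N, Measurable (f N) := fun N => measurable_smoothMax_affine _ _ N
  have hlim : ∀ w, Tendsto (fun N => f N w) atTop (𝓝 (supAffine a c w)) :=
    tendsto_smoothMax_affine ha hc
  calc eLpNorm (fun w => supAffine a c w - ∫ v, supAffine a c v ∂(stdGaussian E)) r (stdGaussian E)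
      ≤ eLpNorm (fun q : E × E => supAffine a c q.2 - supAffine a c q.1) r
          ((stdGaussian E).prod (stdGaussian E)) :=
        eLpNorm_sub_integral_le (integrable_supAffine ha hc) hr
    _ ≤ liminf (fun N => eLpNorm (fun q : E × E => f N q.2 - f N q.1) r
          ((stdGaussian E).prod (stdGaussian E))) atTop :=
        Lp.eLpNorm_lim_le_liminf_eLpNorm (fun N => by fun_prop) _
          (Eventually.of_forall fun q => (hlim q.2).sub (hlim q.1))
    _ ≤ liminf (fun _ : ℕ => ENNReal.ofReal (Real.pi / 2)
          * (ENNReal.ofReal R * eLpNorm id r (gaussianReal 0 1))) atTop :=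
        liminf_le_liminf (Eventually.of_forall fun N =>
          eLpNorm_smoothMax_affine_sub_le _ (fun k => hR _) N hr)
    _ = _ := liminf_const _

end SupAffine

section EnergyProcess

/-- The rank-one matrix `x ⊗ x`, as a Euclidean vector. -/
noncomputable def tensorSq {n : ℕ} (x : Fin n → ℝ) : EuclideanSpace ℝ (Fin n × Fin n) :=
  WithLp.toLp 2 fun ij => x ij.1 * x ij.2

/-- A square matrix as a Euclidean vector, so that a Gaussian matrix becomes a standard Gaussian
vector. -/
noncomputable def matrixVec {n : ℕ} (A : Matrix (Fin n) (Fin n) ℝ) :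
    EuclideanSpace ℝ (Fin n × Fin n) :=
  WithLp.toLp 2 fun ij => A ij.1 ij.2

/-- The sphere `|x|² = n` of `ℝⁿ`, that is, the set of `x` whose normalized `ℓ²` norm is `1`. -/
def normalizedSphere (n : ℕ) : Set (Fin n → ℝ) := {x | x ⬝ᵥ x = n}

/-- The coefficient of the Gaussian vector `matrixVec G` in the energy of `x`. -/
noncomputable def energyCoeff {n : ℕ} (x : Fin n → ℝ) : EuclideanSpace ℝ (Fin n × Fin n) :=
  ((n : ℝ) * √n)⁻¹ • tensorSq x

/-- The deterministic term `-s |x|_p^p / n` of the energy of `x`. -/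
noncomputable def energyDrift {n : ℕ} (p s : ℝ) (x : Fin n → ℝ) : ℝ :=
  -(s * ((1 / (n : ℝ)) * ∑ i, |x i| ^ p))

/-- The random variable `L_{n,p,1}(s)`, as a function of the standard Gaussian vector
`matrixVec G`. -/
noncomputable def unitGroundState (p s : ℝ) (n : ℕ) : EuclideanSpace ℝ (Fin n × Fin n) → ℝ :=
  supAffine (fun x : normalizedSphere n => energyCoeff x.1) fun x => energyDrift p s x.1

/-- The mean `E L_{n,p,1}(s)`. -/
noncomputable def meanGroundState (p s : ℝ) (n : ℕ) : ℝ :=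
  ∫ w, unitGroundState p s n w ∂(stdGaussian (EuclideanSpace ℝ (Fin n × Fin n)))

variable {n : ℕ}

lemma inner_tensorSq_matrixVec (x : Fin n → ℝ) (A : Matrix (Fin n) (Fin n) ℝ) :
    inner ℝ (tensorSq x) (matrixVec A) = (A *ᵥ x) ⬝ᵥ x := by
  simp only [tensorSq, matrixVec, PiLp.inner_apply, RCLike.inner_apply, conj_trivial,
    Fintype.sum_prod_type, Matrix.mulVec, dotProduct, Finset.sum_mul]
  exact Finset.sum_congr rfl fun i _ => Finset.sum_congr rfl fun j _ => by ring

lemma inner_tensorSq (x y : Fin n → ℝ) :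
    inner ℝ (tensorSq x) (tensorSq y) = (x ⬝ᵥ y) ^ 2 := by
  simp only [tensorSq, PiLp.inner_apply, RCLike.inner_apply, conj_trivial, Fintype.sum_prod_type,
    dotProduct, sq, Finset.sum_mul_sum]
  exact Finset.sum_congr rfl fun i _ => Finset.sum_congr rfl fun j _ => by ring

lemma norm_tensorSq_sub_sq (x y : Fin n → ℝ) :
    ‖tensorSq x - tensorSq y‖ ^ 2 = (x ⬝ᵥ x) ^ 2 + (y ⬝ᵥ y) ^ 2 - 2 * (x ⬝ᵥ y) ^ 2 := by
  rw [norm_sub_sq_real, ← real_inner_self_eq_norm_sq, ← real_inner_self_eq_norm_sq, inner_tensorSq,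
    inner_tensorSq, inner_tensorSq]
  ring

lemma norm_tensorSq (x : Fin n → ℝ) : ‖tensorSq x‖ = x ⬝ᵥ x := by
  have h : 0 ≤ x ⬝ᵥ x := Finset.sum_nonneg fun i _ => mul_self_nonneg (x i)
  rw [← sq_eq_sq₀ (norm_nonneg _) h, ← real_inner_self_eq_norm_sq, inner_tensorSq]

instance nonempty_normalizedSphere : Nonempty (normalizedSphere n) :=
  ⟨fun _ => 1, by simp [normalizedSphere, dotProduct]⟩

instance compactSpace_normalizedSphere : CompactSpace (normalizedSphere n) := by
  have hclosed : IsClosed (normalizedSphere n) :=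
    isClosed_eq (by unfold dotProduct; fun_prop) continuous_const
  refine isCompact_iff_compactSpace.1 <| Metric.isCompact_of_isClosed_isBounded hclosed <|
    (Metric.isBounded_closedBall (x := 0) (r := √n)).subset fun x (hx : x ⬝ᵥ x = n) => ?_
  rw [mem_closedBall_zero_iff, pi_norm_le_iff_of_nonneg (Real.sqrt_nonneg _)]
  refine fun i => Real.abs_le_sqrt ?_
  rw [← hx, sq]
  exact Finset.single_le_sum (f := fun j => x j * x j) (fun j _ => mul_self_nonneg _)
    (Finset.mem_univ i)

@[fun_prop]
lemma continuous_energyCoeff : Continuous (energyCoeff (n := n)) := by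
  unfold energyCoeff tensorSq
  fun_prop

lemma continuous_energyDrift {p : ℝ} (hp : 0 ≤ p) (s : ℝ) :
    Continuous (energyDrift (n := n) p s) := by
  unfold energyDrift
  fun_prop (disch := exact fun _ => Or.inr hp)

lemma natCast_rpow_three_half (n : ℕ) : (n : ℝ) ^ (3 / 2 : ℝ) = n * √n := by
  rw [Real.sqrt_eq_rpow, ← Real.rpow_one_add' n.cast_nonneg (by norm_num)]
  norm_num

lemma penalizedEnergy_eq {p : ℝ} (hp : 0 < p) (s : ℝ) (A : Matrix (Fin n) (Fin n) ℝ)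
    (x : Fin n → ℝ) :
    penalizedEnergy p s A x = inner ℝ (energyCoeff x) (matrixVec A) + energyDrift p s x := by
  rw [penalizedEnergy, energyCoeff, energyDrift, normalizedNorm_rpow hp, real_inner_smul_left,
    inner_tensorSq_matrixVec, natCast_rpow_three_half]
  ring

lemma setOf_normalizedNorm_two_sq_eq_one (hn : 0 < n) :
    {x : Fin n → ℝ | normalizedNorm 2 x ^ 2 = 1} = normalizedSphere n := by
  ext x
  have hsum : ∑ i, x i ^ 2 = x ⬝ᵥ x := Finset.sum_congr rfl fun i _ => sq (x i)
  change normalizedNorm 2 x ^ 2 = 1 ↔ x ⬝ᵥ x = n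
  rw [normalizedNorm_two_sq, hsum]
  field_simp

lemma constrainedGroundStateEnergy_one_eq {p : ℝ} (hp : 0 < p) (s : ℝ)
    (A : Matrix (Fin n) (Fin n) ℝ) :
    constrainedGroundStateEnergy p 1 s A = unitGroundState p s n (matrixVec A) := by
  rcases n.eq_zero_or_pos with rfl | hn
  · simp [constrainedGroundStateEnergy, unitGroundState, supAffine, energyCoeff, energyDrift,
      normalizedNorm_two_sq]
  · rw [constrainedGroundStateEnergy, setOf_normalizedNorm_two_sq_eq_one hn, sSup_image',
      unitGroundState, supAffine]
    exact iSup_congr fun x => penalizedEnergy_eq hp s A x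

lemma norm_energyCoeff {x : Fin n → ℝ} (hx : x ∈ normalizedSphere n) :
    ‖energyCoeff x‖ = (√n)⁻¹ := by
  rcases n.eq_zero_or_pos with rfl | hn
  · simp [energyCoeff]
  · rw [energyCoeff, norm_smul, norm_tensorSq, show x ⬝ᵥ x = n from hx,
      Real.norm_of_nonneg (by positivity)]
    field_simp

lemma integrable_unitGroundState {p : ℝ} (hp : 0 ≤ p) (s : ℝ) (n : ℕ) :
    Integrable (unitGroundState p s n) (stdGaussian (EuclideanSpace ℝ (Fin n × Fin n))) :=
  integrable_supAffine (by fun_prop) ((continuous_energyDrift hp s).comp continuous_subtype_val)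

lemma energy_le_unitGroundState {p : ℝ} (hp : 0 ≤ p) (s : ℝ) {x : Fin n → ℝ}
    (hx : x ∈ normalizedSphere n) (w : EuclideanSpace ℝ (Fin n × Fin n)) :
    inner ℝ (energyCoeff x) w + energyDrift p s x ≤ unitGroundState p s n w :=
  le_ciSup (bddAbove_affine (a := fun x : normalizedSphere n => energyCoeff x.1) (by fun_prop)
    ((continuous_energyDrift hp s).comp continuous_subtype_val) w) ⟨x, hx⟩

lemma eLpNorm_unitGroundState_sub_le {p : ℝ} (hp : 0 ≤ p) (s : ℝ) (n : ℕ) {r : ℝ≥0} (hr : 1 ≤ r) :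
    eLpNorm (fun w => unitGroundState p s n w - meanGroundState p s n) r
        (stdGaussian (EuclideanSpace ℝ (Fin n × Fin n)))
      ≤ ENNReal.ofReal (Real.pi / 2)
        * (ENNReal.ofReal (√n)⁻¹ * eLpNorm id r (gaussianReal 0 1)) :=
  eLpNorm_supAffine_sub_integral_le (by fun_prop)
    ((continuous_energyDrift hp s).comp continuous_subtype_val)
    (fun x => (norm_energyCoeff x.2).le) hr

end EnergyProcess

section MeanLimit

lemma append_dotProduct_append {m k : ℕ} (x x' : Fin m → ℝ) (y y' : Fin k → ℝ) :
    Fin.append x y ⬝ᵥ Fin.append x' y' = x ⬝ᵥ x' + y ⬝ᵥ y' := by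
  simp [dotProduct, Fin.sum_univ_add]

lemma append_mem_normalizedSphere {m k : ℕ} {x : Fin m → ℝ} {y : Fin k → ℝ}
    (hx : x ∈ normalizedSphere m) (hy : y ∈ normalizedSphere k) :
    Fin.append x y ∈ normalizedSphere (m + k) := by
  change Fin.append x y ⬝ᵥ Fin.append x y = (m + k : ℕ)
  rw [append_dotProduct_append, show x ⬝ᵥ x = m from hx, show y ⬝ᵥ y = k from hy, Nat.cast_add]

lemma natCast_mul_energyDrift {n : ℕ} (p s : ℝ) (x : Fin n → ℝ) :
    n * energyDrift p s x = -(s * ∑ i, |x i| ^ p) := by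
  rcases n.eq_zero_or_pos with rfl | hn
  · simp
  · rw [energyDrift]
    field_simp

lemma mul_energyDrift_append {m k : ℕ} (p s : ℝ) (x : Fin m → ℝ) (y : Fin k → ℝ) :
    ((m + k : ℕ) : ℝ) * energyDrift p s (Fin.append x y)
      = m * energyDrift p s x + k * energyDrift p s y := by
  simp only [natCast_mul_energyDrift, Fin.sum_univ_add, Fin.append_left, Fin.append_right]
  ring

lemma norm_smul_energyCoeff_sub_sq {n : ℕ} {x y : Fin n → ℝ} (hx : x ∈ normalizedSphere n)
    (hy : y ∈ normalizedSphere n) :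
    ‖(n : ℝ) • energyCoeff x - (n : ℝ) • energyCoeff y‖ ^ 2
      = 2 * n - 2 * ((x ⬝ᵥ y) ^ 2 / n) := by
  have hs : √(n : ℝ) ^ 2 = n := Real.sq_sqrt n.cast_nonneg
  rw [energyCoeff, energyCoeff, ← smul_sub, ← smul_sub, smul_smul, norm_smul, mul_pow,
    norm_tensorSq_sub_sq, show x ⬝ᵥ x = n from hx, show y ⬝ᵥ y = n from hy, Real.norm_eq_abs,
    sq_abs, mul_pow, inv_pow, mul_pow, hs]
  field_simp
  ring

/-- The coefficients of the energies `m H(x) + k H(y)` of two independent systems. -/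
noncomputable def blockCoeff {m k : ℕ} (z : normalizedSphere m × normalizedSphere k) :
    WithLp 2 (EuclideanSpace ℝ (Fin m × Fin m) × EuclideanSpace ℝ (Fin k × Fin k)) :=
  WithLp.toLp 2 ((m : ℝ) • energyCoeff z.1.1, (k : ℝ) • energyCoeff z.2.1)

/-- The coefficients of the energy `(m + k) H(x, y)` of the joint system. -/
noncomputable def jointCoeff {m k : ℕ} (z : normalizedSphere m × normalizedSphere k) :
    EuclideanSpace ℝ (Fin (m + k) × Fin (m + k)) :=
  ((m + k : ℕ) : ℝ) • energyCoeff (Fin.append z.1.1 z.2.1)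

/-- The deterministic term shared by the energies `m H(x) + k H(y)` and `(m + k) H(x, y)`. -/
noncomputable def blockDrift {m k : ℕ} (p s : ℝ) (z : normalizedSphere m × normalizedSphere k) :
    ℝ :=
  m * energyDrift p s z.1.1 + k * energyDrift p s z.2.1

variable {m k : ℕ} {p : ℝ}

@[fun_prop]
lemma continuous_blockCoeff : Continuous (blockCoeff (m := m) (k := k)) := by
  unfold blockCoeff
  fun_prop

@[fun_prop]
lemma continuous_jointCoeff : Continuous (jointCoeff (m := m) (k := k)) := by
  unfold jointCoeff
  fun_prop

lemma continuous_blockDrift (hp : 0 ≤ p) (s : ℝ) :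
    Continuous (blockDrift (m := m) (k := k) p s) := by
  have hm := continuous_energyDrift (n := m) hp s
  have hk := continuous_energyDrift (n := k) hp s
  unfold blockDrift
  fun_prop

lemma norm_blockCoeff_sub_le (hm : 0 < m) (hk : 0 < k)
    (z z' : normalizedSphere m × normalizedSphere k) :
    ‖blockCoeff z - blockCoeff z'‖ ≤ ‖jointCoeff z - jointCoeff z'‖ := by
  have hm' : (0 : ℝ) < m := by exact_mod_cast hm
  have hk' : (0 : ℝ) < k := by exact_mod_cast hk
  obtain ⟨⟨x, hx⟩, ⟨y, hy⟩⟩ := z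
  obtain ⟨⟨x', hx'⟩, ⟨y', hy'⟩⟩ := z'
  have htitu : (x ⬝ᵥ x' + y ⬝ᵥ y') ^ 2 / ((m : ℝ) + k)
      ≤ (x ⬝ᵥ x') ^ 2 / m + (y ⬝ᵥ y') ^ 2 / k := by
    rw [div_add_div _ _ hm'.ne' hk'.ne', div_le_div_iff₀ (by positivity) (by positivity)]
    linarith [sq_nonneg ((x ⬝ᵥ x') * k - (y ⬝ᵥ y') * m)]
  rw [← sq_le_sq₀ (norm_nonneg _) (norm_nonneg _)]
  calc ‖blockCoeff (⟨x, hx⟩, ⟨y, hy⟩) - blockCoeff (⟨x', hx'⟩, ⟨y', hy'⟩)‖ ^ 2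
      = (2 * m - 2 * ((x ⬝ᵥ x') ^ 2 / m)) + (2 * k - 2 * ((y ⬝ᵥ y') ^ 2 / k)) := by
        rw [← norm_smul_energyCoeff_sub_sq hx hx', ← norm_smul_energyCoeff_sub_sq hy hy',
          WithLp.prod_norm_sq_eq_of_L2]
        rfl
    _ ≤ 2 * (m + k : ℕ) - 2 * ((x ⬝ᵥ x' + y ⬝ᵥ y') ^ 2 / (m + k : ℕ)) := by
        push_cast
        linarith
    _ = ‖jointCoeff (⟨x, hx⟩, ⟨y, hy⟩) - jointCoeff (⟨x', hx'⟩, ⟨y', hy'⟩)‖ ^ 2 := by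
        rw [← append_dotProduct_append]
        exact (norm_smul_energyCoeff_sub_sq (append_mem_normalizedSphere hx hy)
          (append_mem_normalizedSphere hx' hy')).symm

lemma exists_unitGroundState_eq {n : ℕ} (hp : 0 ≤ p) (s : ℝ)
    (w : EuclideanSpace ℝ (Fin n × Fin n)) : ∃ x : normalizedSphere n,
      unitGroundState p s n w = inner ℝ (energyCoeff x.1) w + energyDrift p s x.1 :=
  exists_supAffine_eq (by fun_prop)
    ((continuous_energyDrift hp s).comp continuous_subtype_val) w

lemma mul_unitGroundState_add_le (hp : 0 ≤ p) (s : ℝ)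
    (w : WithLp 2 (EuclideanSpace ℝ (Fin m × Fin m) × EuclideanSpace ℝ (Fin k × Fin k))) :
    m * unitGroundState p s m w.fst + k * unitGroundState p s k w.snd
      ≤ supAffine blockCoeff (blockDrift p s) w := by
  obtain ⟨x, hx⟩ := exists_unitGroundState_eq hp s w.fst
  obtain ⟨y, hy⟩ := exists_unitGroundState_eq hp s w.snd
  refine le_of_eq_of_le ?_
    (le_ciSup (bddAbove_affine continuous_blockCoeff (continuous_blockDrift hp s) w) (x, y))
  rw [hx, hy, WithLp.prod_inner_apply]
  simp only [blockCoeff, blockDrift, real_inner_smul_left, WithLp.ofLp_fst, WithLp.ofLp_snd]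
  ring

lemma supAffine_jointCoeff_le (hp : 0 ≤ p) (s : ℝ)
    (w : EuclideanSpace ℝ (Fin (m + k) × Fin (m + k))) :
    supAffine jointCoeff (blockDrift p s) w
      ≤ ((m + k : ℕ) : ℝ) * unitGroundState p s (m + k) w := by
  refine ciSup_le fun ⟨⟨x, hx⟩, ⟨y, hy⟩⟩ => ?_
  rw [jointCoeff, blockDrift, real_inner_smul_left, ← mul_energyDrift_append, ← mul_add]
  exact mul_le_mul_of_nonneg_left
    (energy_le_unitGroundState hp s (append_mem_normalizedSphere hx hy) w) (Nat.cast_nonneg _)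

theorem mul_meanGroundState_add_le (hm : 0 < m) (hk : 0 < k) (hp : 0 ≤ p) (s : ℝ) :
    m * meanGroundState p s m + k * meanGroundState p s k
      ≤ ((m + k : ℕ) : ℝ) * meanGroundState p s (m + k) := by
  let μ := stdGaussian
    (WithLp 2 (EuclideanSpace ℝ (Fin m × Fin m) × EuclideanSpace ℝ (Fin k × Fin k)))
  have hfst : MeasurePreserving (fun w => w.fst) μ (stdGaussian _) :=
    measurePreserving_fst_stdGaussian
  have hsnd : MeasurePreserving (fun w => w.snd) μ (stdGaussian _) :=
    measurePreserving_snd_stdGaussian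
  have hm_int := integrable_unitGroundState hp s m
  have hk_int := integrable_unitGroundState hp s k
  have hfst_int : Integrable (fun w => (m : ℝ) * unitGroundState p s m w.fst) μ :=
    (hfst.integrable_comp_of_integrable hm_int).const_mul _
  have hsnd_int : Integrable (fun w => (k : ℝ) * unitGroundState p s k w.snd) μ :=
    (hsnd.integrable_comp_of_integrable hk_int).const_mul _
  have hdrift := continuous_blockDrift (m := m) (k := k) hp s
  calc m * meanGroundState p s m + k * meanGroundState p s k
      = ∫ w, m * unitGroundState p s m w.fst + k * unitGroundState p s k w.snd ∂μ := by
        rw [integral_add hfst_int hsnd_int, integral_const_mul, integral_const_mul,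
          ← integral_map hfst.aemeasurable (hfst.map_eq ▸ hm_int.1),
          ← integral_map hsnd.aemeasurable (hsnd.map_eq ▸ hk_int.1), hfst.map_eq, hsnd.map_eq]
        rfl
    _ ≤ ∫ w, supAffine blockCoeff (blockDrift p s) w ∂μ :=
        integral_mono (hfst_int.add hsnd_int) (integrable_supAffine (by fun_prop) hdrift)
          (mul_unitGroundState_add_le hp s)
    _ ≤ ∫ w, supAffine (jointCoeff (m := m) (k := k)) (blockDrift p s) w ∂(stdGaussian _) :=
        integral_supAffine_le_of_norm_sub_le (by fun_prop) (by fun_prop) hdrift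
          (norm_blockCoeff_sub_le hm hk)
    _ ≤ ∫ w, ((m + k : ℕ) : ℝ) * unitGroundState p s (m + k) w ∂(stdGaussian _) :=
        integral_mono (integrable_supAffine (by fun_prop) hdrift)
          ((integrable_unitGroundState hp s _).const_mul _) (supAffine_jointCoeff_le hp s)
    _ = ((m + k : ℕ) : ℝ) * meanGroundState p s (m + k) := integral_const_mul _ _

lemma energyDrift_nonpos {n : ℕ} {s : ℝ} (hs : 0 ≤ s) (x : Fin n → ℝ) :
    energyDrift p s x ≤ 0 := by
  rw [energyDrift, neg_nonpos]
  positivity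

lemma norm_toLp_sub_sq {n : ℕ} (x y : Fin n → ℝ) :
    ‖(WithLp.toLp 2 x - WithLp.toLp 2 y : EuclideanSpace ℝ (Fin n))‖ ^ 2
      = x ⬝ᵥ x + y ⬝ᵥ y - 2 * (x ⬝ᵥ y) := by
  rw [EuclideanSpace.real_norm_sq_eq]
  simp only [dotProduct, Finset.mul_sum, ← Finset.sum_add_distrib, ← Finset.sum_sub_distrib]
  exact Finset.sum_congr rfl fun i _ => by simp only [PiLp.sub_apply]; ring

/-- On the sphere `|x ⊗ x - y ⊗ y|² = (n - ⟨x, y⟩) (2 n + 2 ⟨x, y⟩)` while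
`|x - y|² = 2 (n - ⟨x, y⟩)`. -/
lemma norm_energyCoeff_sub_le {n : ℕ} {x y : Fin n → ℝ} (hx : x ∈ normalizedSphere n)
    (hy : y ∈ normalizedSphere n) : ‖energyCoeff x - energyCoeff y‖
      ≤ ‖(√2 / n) • (WithLp.toLp 2 x - WithLp.toLp 2 y : EuclideanSpace ℝ (Fin n))‖ := by
  have hdist := norm_toLp_sub_sq x y
  have hsub := norm_tensorSq_sub_sq x y
  rw [show x ⬝ᵥ x = n from hx, show y ⬝ᵥ y = n from hy] at hdist hsub
  have htensor : ‖tensorSq x - tensorSq y‖ ^ 2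
      ≤ 2 * n * ‖(WithLp.toLp 2 x - WithLp.toLp 2 y : EuclideanSpace ℝ (Fin n))‖ ^ 2 := by
    rw [hdist, hsub]
    linarith [sq_nonneg ((n : ℝ) - x ⬝ᵥ y)]
  rcases n.eq_zero_or_pos with rfl | hn
  · simp [energyCoeff]
  have hs : √(n : ℝ) ^ 2 = n := Real.sq_sqrt n.cast_nonneg
  rw [← sq_le_sq₀ (norm_nonneg _) (norm_nonneg _), energyCoeff, energyCoeff, ← smul_sub, norm_smul,
    norm_smul, Real.norm_of_nonneg (by positivity), Real.norm_of_nonneg (by positivity), mul_pow,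
    mul_pow, inv_pow, mul_pow, div_pow, hs, Real.sq_sqrt zero_le_two,
    inv_mul_le_iff₀ (by positivity)]
  refine htensor.trans_eq ?_
  field_simp

lemma meanGroundState_le (hp : 0 ≤ p) {s : ℝ} (hs : 0 ≤ s) (n : ℕ) :
    meanGroundState p s n ≤ √2 := by
  have hdrift : Continuous fun x : normalizedSphere n => energyDrift p s x.1 :=
    (continuous_energyDrift hp s).comp continuous_subtype_val
  have hnorm : ∀ x : normalizedSphere n,
      ‖(√2 / n) • (WithLp.toLp 2 x.1 : EuclideanSpace ℝ (Fin n))‖ ≤ √2 / n * √n := fun x => by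
    have h := norm_toLp_sub_sq x.1 0
    rw [show x.1 ⬝ᵥ x.1 = n from x.2] at h
    rw [norm_smul, Real.norm_of_nonneg (by positivity)]
    exact mul_le_mul_of_nonneg_left (Real.le_sqrt_of_sq_le (by simpa using h.le)) (by positivity)
  calc meanGroundState p s n
      ≤ ∫ w, supAffine (fun x : normalizedSphere n =>
          (√2 / n) • (WithLp.toLp 2 x.1 : EuclideanSpace ℝ (Fin n)))
          (fun x => energyDrift p s x.1) w ∂(stdGaussian (EuclideanSpace ℝ (Fin n))) :=
        integral_supAffine_le_of_norm_sub_le (by fun_prop) (by fun_prop) hdrift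
          fun x y => by simpa only [smul_sub] using norm_energyCoeff_sub_le x.2 y.2
    _ ≤ √2 / n * √n * √(Module.finrank ℝ (EuclideanSpace ℝ (Fin n))) :=
        integral_supAffine_le_of_norm_le (by fun_prop) hdrift hnorm
          fun x => energyDrift_nonpos hs x.1
    _ = √2 * (n / n) := by
        rw [finrank_euclideanSpace_fin, mul_assoc, Real.mul_self_sqrt n.cast_nonneg]
        ring
    _ ≤ √2 := mul_le_of_le_one_right (Real.sqrt_nonneg _) (div_self_le_one _)

/-- The limit of `E L_{n,p,1}(s)`. -/
noncomputable def limitGroundState (p s : ℝ) : ℝ := limUnder atTop (meanGroundState p s)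

theorem tendsto_meanGroundState (hp : 0 ≤ p) {s : ℝ} (hs : 0 ≤ s) :
    Tendsto (meanGroundState p s) atTop (𝓝 (limitGroundState p s)) := by
  have hsub : Subadditive fun n : ℕ => -((n : ℝ) * meanGroundState p s n) := by
    intro m k
    rcases m.eq_zero_or_pos with rfl | hm
    · simp
    rcases k.eq_zero_or_pos with rfl | hk
    · simp
    linarith [mul_meanGroundState_add_le hm hk hp s]
  have hdiv : ∀ n : ℕ, 0 < n →
      -((n : ℝ) * meanGroundState p s n) / n = -meanGroundState p s n := fun n hn => by
    field_simp
  have hbdd : BddBelow (Set.range fun n : ℕ => -((n : ℝ) * meanGroundState p s n) / n) := by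
    refine ⟨-√2, ?_⟩
    rintro _ ⟨n, rfl⟩
    rcases n.eq_zero_or_pos with rfl | hn
    · simp
    · simpa only [hdiv n hn] using neg_le_neg (meanGroundState_le hp hs n)
  refine tendsto_nhds_limUnder ⟨_, (hsub.tendsto_lim hbdd).neg.congr' ?_⟩
  filter_upwards [eventually_gt_atTop 0] with n hn
  rw [hdiv n hn, neg_neg]

end MeanLimit

section AntitoneLimits

lemma nonneg_of_antitoneOn_of_mul_le {φ : ℝ → ℝ} (hφ : AntitoneOn φ (Set.Ioi 0)) {L : ℝ}
    (hL : ∀ u, 0 < u → u * φ u ≤ L) : 0 ≤ L := by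
  have hlim : Tendsto (fun u : ℝ => u * φ 1) (𝓝[>] 0) (𝓝 0) := by
    have h : Tendsto (fun u : ℝ => u * φ 1) (𝓝 0) (𝓝 (0 * φ 1)) := tendsto_id.mul_const _
    rw [zero_mul] at h
    exact h.mono_left nhdsWithin_le_nhds
  refine le_of_tendsto hlim (mem_of_superset (Ioc_mem_nhdsGT one_pos) fun u hu => ?_)
  exact (mul_le_mul_of_nonneg_left (hφ hu.1 (Set.mem_Ioi.2 one_pos) hu.2) hu.1.le).trans
    (hL u hu.1)

lemma antitoneOn_comp_mul_rpow {f : ℝ → ℝ} (hf : AntitoneOn f (Set.Ici 0)) {t α : ℝ} (ht : 0 ≤ t)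
    (hα : 0 ≤ α) : AntitoneOn (fun u => f (t * u ^ α)) (Set.Ici 0) := by
  intro u hu v hv huv
  have hu₀ : 0 ≤ u := hu
  have hv₀ : 0 ≤ v := hv
  exact hf (Set.mem_Ici.2 (by positivity)) (Set.mem_Ici.2 (by positivity)) (by gcongr)

lemma bddAbove_mul_of_antitoneOn {φ : ℝ → ℝ} (hφ : AntitoneOn φ (Set.Ici 0)) {U : ℝ} (hU : 0 ≤ U)
    (hφU : φ U ≤ 0) : BddAbove ((fun u => u * φ u) '' Set.Ioi 0) := by
  refine ⟨U * |φ 0|, ?_⟩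
  rintro _ ⟨u, hu, rfl⟩
  have hu₀ : 0 ≤ u := le_of_lt hu
  rcases le_total u U with huU | hUu
  · calc u * φ u ≤ u * |φ 0| :=
          mul_le_mul_of_nonneg_left ((hφ Set.self_mem_Ici hu₀ hu₀).trans (le_abs_self _)) hu₀
      _ ≤ U * |φ 0| := mul_le_mul_of_nonneg_right huU (abs_nonneg _)
  · exact (mul_nonpos_of_nonneg_of_nonpos hu₀ ((hφ hU hu₀ hUu).trans hφU)).trans (by positivity)

variable {ι : Type*} {l : Filter ι}

lemma antitoneOn_of_tendsto {α β : Type*} [Preorder α] [TopologicalSpace β] [Preorder β]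
    [OrderClosedTopology β] [l.NeBot] {f : ι → α → β} {g : α → β} {s : Set α}
    (hf : ∀ i, AntitoneOn (f i) s) (hlim : ∀ x ∈ s, Tendsto (f · x) l (𝓝 (g x))) :
    AntitoneOn g s :=
  fun x hx y hy hxy => le_of_tendsto_of_tendsto' (hlim y hy) (hlim x hx) fun i => hf i hx hy hxy

section Supremum

variable {ψ : ι → ℝ → ℝ} {φ : ℝ → ℝ} {U L : ℝ}

/-- Monotonicity makes a fine finite grid in `[0, U]` control all `u ≤ U`; beyond `U` the functions
are eventually negative. -/
lemma eventually_forall_mul_lt (hψ : ∀ i, AntitoneOn (ψ i) (Set.Ici 0))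
    (hφ : AntitoneOn φ (Set.Ici 0)) (hlim : ∀ u, 0 ≤ u → Tendsto (ψ · u) l (𝓝 (φ u))) (hU : 0 ≤ U)
    (hφU : φ U < 0) (hL : ∀ u, 0 < u → u * φ u ≤ L) {r : ℝ} (hr : L < r) :
    ∀ᶠ i in l, ∀ u, 0 < u → u * ψ i u < r := by
  have hL₀ : 0 ≤ L := nonneg_of_antitoneOn_of_mul_le (hφ.mono Set.Ioi_subset_Ici_self) hL
  obtain ⟨δ, hδ, hδr⟩ : ∃ δ, 0 < δ ∧ L + δ * |φ 0| < r := by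
    obtain ⟨δ, hδ, h⟩ := exists_pos_mul_lt (sub_pos.2 hr) |φ 0|
    exact ⟨δ, hδ, by linarith⟩
  have hgrid : ∀ a, 0 ≤ a → (a + δ) * max (φ a) 0 < r := fun a ha => by
    have haφ : a * max (φ a) 0 ≤ L := by
      rw [mul_max_of_nonneg _ _ ha, mul_zero]
      rcases ha.eq_or_lt with rfl | ha'
      · simpa using hL₀
      · exact max_le (hL a ha') hL₀
    have hδφ : δ * max (φ a) 0 ≤ δ * |φ 0| := mul_le_mul_of_nonneg_left
      (max_le ((hφ Set.self_mem_Ici ha ha).trans (le_abs_self _)) (abs_nonneg _)) hδ.le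
    linarith
  have hgrid_ev : ∀ᶠ i in l, ∀ k ∈ Finset.range (⌊U / δ⌋₊ + 1),
      (k * δ + δ) * max (ψ i (k * δ)) 0 < r := by
    refine (Finset.eventually_all _).2 fun k _ => ?_
    have hk : 0 ≤ k * δ := by positivity
    exact (((hlim _ hk).max tendsto_const_nhds).const_mul _).eventually_lt_const (hgrid _ hk)
  filter_upwards [hgrid_ev, (hlim U hU).eventually_lt_const hφU] with i hi hiU u hu
  rcases le_total U u with hUu | huU
  · exact (mul_neg_of_pos_of_neg hu ((hψ i hU hu.le hUu).trans_lt hiU)).trans_le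
      (hL₀.trans hr.le)
  set k := ⌊u / δ⌋₊
  have hku : k * δ ≤ u := (le_div_iff₀ hδ).1 (Nat.floor_le (by positivity))
  have huk : u ≤ k * δ + δ := by
    linarith [(div_lt_iff₀ hδ).1 (Nat.lt_floor_add_one (u / δ))]
  have hkU : k ∈ Finset.range (⌊U / δ⌋₊ + 1) :=
    Finset.mem_range_succ_iff.2 (Nat.floor_mono (by gcongr))
  have hk : 0 ≤ k * δ := by positivity
  calc u * ψ i u ≤ u * max (ψ i (k * δ)) 0 :=
        mul_le_mul_of_nonneg_left ((hψ i hk hu.le hku).trans (le_max_left _ _)) hu.le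
    _ ≤ (k * δ + δ) * max (ψ i (k * δ)) 0 :=
        mul_le_mul_of_nonneg_right huk (le_max_right _ _)
    _ < r := hi k hkU

lemma tendsto_of_isLUB_mul (hψ : ∀ i, AntitoneOn (ψ i) (Set.Ici 0))
    (hφ : AntitoneOn φ (Set.Ici 0)) (hlim : ∀ u, 0 ≤ u → Tendsto (ψ · u) l (𝓝 (φ u))) (hU : 0 ≤ U)
    (hφU : φ U < 0) (hL : IsLUB ((fun u => u * φ u) '' Set.Ioi 0) L) {S : ι → ℝ}
    (hS : ∀ᶠ i in l, IsLUB ((fun u => u * ψ i u) '' Set.Ioi 0) (S i)) : Tendsto S l (𝓝 L) := by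
  refine tendsto_order.2 ⟨fun a ha => ?_, fun r hr => ?_⟩
  · obtain ⟨_, ⟨u, hu, rfl⟩, hau⟩ := (lt_isLUB_iff hL).1 ha
    filter_upwards [hS, ((hlim u (le_of_lt hu)).const_mul u).eventually_const_lt hau] with i hi hai
    exact hai.trans_le (hi.1 ⟨u, hu, rfl⟩)
  · obtain ⟨r', hLr', hr'r⟩ := exists_between hr
    filter_upwards [hS, eventually_forall_mul_lt hψ hφ hlim hU hφU
      (fun u hu => hL.1 ⟨u, hu, rfl⟩) hLr'] with i hi hir
    refine (hi.2 ?_).trans_lt hr'r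
    rintro _ ⟨u, hu, rfl⟩
    exact (hir u hu).le

end Supremum

lemma tendsto_of_antitone_of_dense {f : ι → ℝ → ℝ} (hf : ∀ i, Antitone (f i)) {g : ℝ → ℝ} {s : ℝ}
    (hg : ContinuousAt g s) {D : Set ℝ} (hD : Dense D)
    (hlim : ∀ᶠ x in 𝓝 s, x ∈ D → Tendsto (f · x) l (𝓝 (g x))) :
    Tendsto (f · s) l (𝓝 (g s)) := by
  refine tendsto_order.2 ⟨fun a ha => ?_, fun b hb => ?_⟩
  · obtain ⟨y, hy, hIco⟩ := exists_Ico_subset_of_mem_nhds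
      (hlim.and (hg.eventually_const_lt ha)) (exists_gt s)
    obtain ⟨x, hxD, hsx, hxy⟩ := hD.exists_between hy
    obtain ⟨hx, hax⟩ := hIco ⟨hsx.le, hxy⟩
    filter_upwards [(hx hxD).eventually_const_lt hax] with i hi
    exact hi.trans_le (hf i hsx.le)
  · obtain ⟨y, hy, hIoc⟩ := exists_Ioc_subset_of_mem_nhds
      (hlim.and (hg.eventually_lt_const hb)) (exists_lt s)
    obtain ⟨x, hxD, hyx, hxs⟩ := hD.exists_between hy
    obtain ⟨hx, hxb⟩ := hIoc ⟨hyx, hxs.le⟩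
    filter_upwards [(hx hxD).eventually_lt_const hxb] with i hi
    exact (hf i hxs.le).trans_lt hi

end AntitoneLimits

section Deterministic

variable {n : ℕ} {p : ℝ}

lemma normalizedNorm_two_smul_sq (c : ℝ) (x : Fin n → ℝ) :
    normalizedNorm 2 (c • x) ^ 2 = c ^ 2 * normalizedNorm 2 x ^ 2 := by
  simp only [normalizedNorm_two_sq, Pi.smul_apply, smul_eq_mul, mul_pow, ← Finset.mul_sum]
  ring

lemma penalizedEnergy_sqrt_smul (hp : 0 < p) {u : ℝ} (hu : 0 < u) (t : ℝ)
    (A : Matrix (Fin n) (Fin n) ℝ) (x : Fin n → ℝ) :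
    penalizedEnergy p t A (√u • x) = u * penalizedEnergy p (t * u ^ (p / 2 - 1)) A x := by
  have hcoord : ∀ i, |(√u • x) i| ^ p = u ^ (p / 2) * |x i| ^ p := fun i => by
    rw [Pi.smul_apply, smul_eq_mul, abs_mul, abs_of_nonneg (Real.sqrt_nonneg u),
      Real.mul_rpow (Real.sqrt_nonneg u) (abs_nonneg _), Real.sqrt_eq_rpow, ← Real.rpow_mul hu.le,
      one_div_mul_eq_div]
  have hpow : u ^ (p / 2) = u * u ^ (p / 2 - 1) := by
    rw [Real.rpow_sub_one hu.ne', mul_div_cancel₀ _ hu.ne']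
  simp only [penalizedEnergy, normalizedNorm_rpow hp, hcoord, ← Finset.mul_sum, Matrix.mulVec_smul,
    smul_dotProduct, dotProduct_smul, smul_eq_mul, hpow]
  rw [← mul_assoc √u, Real.mul_self_sqrt hu.le]
  ring

open scoped Pointwise in
lemma constrainedGroundStateEnergy_eq_mul (hp : 0 < p) {u : ℝ} (hu : 0 < u) (t : ℝ)
    (A : Matrix (Fin n) (Fin n) ℝ) : constrainedGroundStateEnergy p u t A
      = u * unitGroundState p (t * u ^ (p / 2 - 1)) n (matrixVec A) := by
  have hsphere : {x : Fin n → ℝ | normalizedNorm 2 x ^ 2 = u}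
      = √u • {x : Fin n → ℝ | normalizedNorm 2 x ^ 2 = 1} := by
    ext x
    rw [Set.mem_smul_set_iff_inv_smul_mem₀ (Real.sqrt_pos.2 hu).ne', Set.mem_ofPred_eq,
      Set.mem_ofPred_eq, normalizedNorm_two_smul_sq, inv_pow, Real.sq_sqrt hu.le,
      inv_mul_eq_one₀ hu.ne', eq_comm]
  rw [← constrainedGroundStateEnergy_one_eq hp, constrainedGroundStateEnergy,
    constrainedGroundStateEnergy, hsphere, ← Set.image_smul, Set.image_image, sSup_image',
    sSup_image', Real.mul_iSup_of_nonneg hu.le]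
  exact iSup_congr fun x => penalizedEnergy_sqrt_smul hp hu t A x

lemma antitone_unitGroundState (hp : 0 ≤ p) (w : EuclideanSpace ℝ (Fin n × Fin n)) :
    Antitone fun s => unitGroundState p s n w := by
  intro s s' hss
  obtain ⟨x, hx⟩ := exists_unitGroundState_eq hp s' w
  change unitGroundState p s' n w ≤ unitGroundState p s n w
  rw [hx]
  refine le_trans ?_ (energy_le_unitGroundState hp s x.2 w)
  unfold energyDrift
  gcongr

lemma convexOn_unitGroundState (hp : 0 ≤ p) (w : EuclideanSpace ℝ (Fin n × Fin n)) :
    ConvexOn ℝ Set.univ fun s => unitGroundState p s n w := by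
  refine ⟨convex_univ, fun s _ s' _ a b ha hb hab => ?_⟩
  obtain ⟨x, hx⟩ := exists_unitGroundState_eq hp (a • s + b • s') w
  have hs := mul_le_mul_of_nonneg_left (energy_le_unitGroundState hp s x.2 w) ha
  have hs' := mul_le_mul_of_nonneg_left (energy_le_unitGroundState hp s' x.2 w) hb
  calc unitGroundState p (a • s + b • s') n w
      = (a + b) * inner ℝ (energyCoeff x.1) w + energyDrift p (a • s + b • s') x.1 := by
        rw [hx, hab, one_mul]
    _ = a * (inner ℝ (energyCoeff x.1) w + energyDrift p s x.1)
          + b * (inner ℝ (energyCoeff x.1) w + energyDrift p s' x.1) := by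
        simp only [energyDrift, smul_eq_mul]
        ring
    _ ≤ a • unitGroundState p s n w + b • unitGroundState p s' n w := add_le_add hs hs'

lemma energyDrift_le_neg (hn : 0 < n) (hp : 2 ≤ p) {s : ℝ} (hs : 0 ≤ s) {x : Fin n → ℝ}
    (hx : x ∈ normalizedSphere n) : energyDrift p s x ≤ -s := by
  have hpow : ∀ i, (x i ^ 2) ^ (p / 2) = |x i| ^ p := fun i => by
    rw [← sq_abs, ← Real.rpow_natCast, ← Real.rpow_mul (abs_nonneg _)]
    congr 1
    push_cast
    ring
  have hmean : ∑ i, 1 / (n : ℝ) * x i ^ 2 = 1 := by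
    have hsum : ∑ i, x i ^ 2 = n := by
      simpa only [dotProduct, ← sq] using show x ⬝ᵥ x = n from hx
    rw [← Finset.mul_sum, hsum]
    field_simp
  have hweights : ∑ _i : Fin n, 1 / (n : ℝ) = 1 := by
    rw [Finset.sum_const, Finset.card_univ, Fintype.card_fin, nsmul_eq_mul]
    field_simp
  have hjensen := Real.rpow_arith_mean_le_arith_mean_rpow Finset.univ (fun _ : Fin n => 1 / (n : ℝ))
    (fun i => x i ^ 2) (fun _ _ => by positivity) hweights (fun i _ => sq_nonneg (x i))
    (show 1 ≤ p / 2 by linarith)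
  simp only [hmean, Real.one_rpow, hpow, ← Finset.mul_sum] at hjensen
  exact neg_le_neg (le_mul_of_one_le_right hs hjensen)

lemma unitGroundState_le_sub (hn : 0 < n) (hp : 2 ≤ p) {s : ℝ} (hs : 0 ≤ s)
    (w : EuclideanSpace ℝ (Fin n × Fin n)) :
    unitGroundState p s n w ≤ unitGroundState p 0 n w - s := by
  have hp₀ : 0 ≤ p := zero_le_two.trans hp
  obtain ⟨x, hx⟩ := exists_unitGroundState_eq hp₀ s w
  have hzero := energy_le_unitGroundState hp₀ 0 x.2 w
  have hdrift := energyDrift_le_neg hn hp hs x.2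
  rw [energyDrift, zero_mul, neg_zero, add_zero] at hzero
  linarith

lemma antitoneOn_unitGroundState_mul_rpow (hp : 2 ≤ p) {t : ℝ} (ht : 0 ≤ t)
    (w : EuclideanSpace ℝ (Fin n × Fin n)) :
    AntitoneOn (fun u => unitGroundState p (t * u ^ (p / 2 - 1)) n w) (Set.Ici 0) :=
  antitoneOn_comp_mul_rpow
    ((antitone_unitGroundState (zero_le_two.trans hp) w).antitoneOn _) ht (by linarith)

lemma isLUB_groundStateEnergy (hn : 0 < n) (hp : 2 < p) {t : ℝ} (ht : 0 < t)
    (A : Matrix (Fin n) (Fin n) ℝ) :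
    IsLUB ((fun u => u * unitGroundState p (t * u ^ (p / 2 - 1)) n (matrixVec A)) '' Set.Ioi 0)
      (groundStateEnergy p t A) := by
  have hp₀ : 0 < p := by linarith
  have hgreatest := isGreatest_groundStateEnergy hn hp ht A
  have hconstrained : ∀ u, 0 < u → IsGreatest
      (penalizedEnergy p t A '' {x | normalizedNorm 2 x ^ 2 = u})
      (u * unitGroundState p (t * u ^ (p / 2 - 1)) n (matrixVec A)) := fun u hu => by
    rw [← constrainedGroundStateEnergy_eq_mul hp₀ hu]
    exact isGreatest_constrainedGroundStateEnergy hn hp hu t A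
  refine ⟨?_, fun b hb => ?_⟩
  · rintro _ ⟨u, hu, rfl⟩
    exact hgreatest.2 (Set.image_subset_range _ _ (hconstrained u hu).1)
  obtain ⟨x, hx⟩ := hgreatest.1
  rw [← hx]
  rcases (sq_nonneg (normalizedNorm 2 x)).eq_or_lt with hx₀ | hx₀
  · have hzero : x = 0 := by
      rw [normalizedNorm_two_sq, eq_comm, mul_eq_zero_iff_left (by positivity),
        Finset.sum_eq_zero_iff_of_nonneg fun i _ => sq_nonneg (x i)] at hx₀
      exact funext fun i => pow_eq_zero_iff two_ne_zero |>.1 (hx₀ i (Finset.mem_univ i))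
    have henergy : penalizedEnergy p t A x = 0 := by
      simp [hzero, penalizedEnergy, normalizedNorm_rpow hp₀, Real.zero_rpow hp₀.ne']
    rw [henergy]
    exact nonneg_of_antitoneOn_of_mul_le
      ((antitoneOn_unitGroundState_mul_rpow hp.le ht.le _).mono Set.Ioi_subset_Ici_self)
      fun u hu => hb ⟨u, hu, rfl⟩
  · exact ((hconstrained _ hx₀).2 ⟨x, rfl, rfl⟩).trans (hb ⟨_, hx₀, rfl⟩)

end Deterministic

section LimitFormula

variable {p : ℝ}

lemma antitone_meanGroundState (hp : 0 ≤ p) (n : ℕ) : Antitone fun s => meanGroundState p s n :=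
  fun s s' hss => integral_mono (integrable_unitGroundState hp s' n)
    (integrable_unitGroundState hp s n) fun w => antitone_unitGroundState hp w hss

lemma convexOn_meanGroundState (hp : 0 ≤ p) (n : ℕ) :
    ConvexOn ℝ Set.univ fun s => meanGroundState p s n := by
  refine ⟨convex_univ, fun s hs s' hs' a b ha hb hab => ?_⟩
  have hint : ∀ s, Integrable (unitGroundState p s n) (stdGaussian _) := fun s =>
    integrable_unitGroundState hp s n
  calc meanGroundState p (a • s + b • s') n
      ≤ ∫ w, (a * unitGroundState p s n w + b * unitGroundState p s' n w) ∂(stdGaussian _) :=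
        integral_mono (hint _) (((hint s).const_mul a).add ((hint s').const_mul b)) fun w =>
          (convexOn_unitGroundState hp w).2 hs hs' ha hb hab
    _ = a • meanGroundState p s n + b • meanGroundState p s' n := by
        rw [integral_add ((hint s).const_mul a) ((hint s').const_mul b), integral_const_mul,
          integral_const_mul]
        rfl

lemma meanGroundState_le_sub {n : ℕ} (hn : 0 < n) (hp : 2 ≤ p) {s : ℝ} (hs : 0 ≤ s) :
    meanGroundState p s n ≤ meanGroundState p 0 n - s := by
  have hp₀ : 0 ≤ p := zero_le_two.trans hp
  have hint := integrable_unitGroundState hp₀ 0 n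
  calc meanGroundState p s n
      ≤ ∫ w, (unitGroundState p 0 n w - s) ∂(stdGaussian _) :=
        integral_mono (integrable_unitGroundState hp₀ s n) (hint.sub (integrable_const s))
          (unitGroundState_le_sub hn hp hs)
    _ = meanGroundState p 0 n - s := by
        rw [integral_sub hint (integrable_const s), integral_const, probReal_univ, one_smul]
        rfl

lemma antitoneOn_limitGroundState (hp : 0 ≤ p) : AntitoneOn (limitGroundState p) (Set.Ici 0) :=
  antitoneOn_of_tendsto (fun n => (antitone_meanGroundState hp n).antitoneOn _)
    fun _ hs => tendsto_meanGroundState hp hs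

lemma convexOn_limitGroundState (hp : 0 ≤ p) : ConvexOn ℝ (Set.Ici 0) (limitGroundState p) := by
  refine ⟨convex_Ici 0, fun s hs s' hs' a b ha hb hab => ?_⟩
  have hlim : ∀ s ∈ Set.Ici (0 : ℝ), Tendsto (meanGroundState p s) atTop
      (𝓝 (limitGroundState p s)) := fun s hs => tendsto_meanGroundState hp hs
  exact le_of_tendsto_of_tendsto' (hlim _ (convex_Ici 0 hs hs' ha hb hab))
    (((hlim s hs).const_smul a).add ((hlim s' hs').const_smul b)) fun n =>
      (convexOn_meanGroundState hp n).2 trivial trivial ha hb hab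

lemma limitGroundState_le_sub (hp : 2 ≤ p) {s : ℝ} (hs : 0 ≤ s) :
    limitGroundState p s ≤ limitGroundState p 0 - s := by
  have hp₀ : 0 ≤ p := zero_le_two.trans hp
  refine le_of_tendsto_of_tendsto (tendsto_meanGroundState hp₀ hs)
    ((tendsto_meanGroundState hp₀ le_rfl).sub_const s) ?_
  filter_upwards [eventually_gt_atTop 0] with n hn using meanGroundState_le_sub hn hp hs

lemma exists_limitGroundState_mul_rpow_neg (hp : 2 < p) {t : ℝ} (ht : 0 < t) :
    ∃ U, 0 ≤ U ∧ limitGroundState p (t * U ^ (p / 2 - 1)) < 0 := by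
  set s := |limitGroundState p 0| + 1
  refine ⟨(s / t) ^ (p / 2 - 1)⁻¹, by positivity, ?_⟩
  rw [Real.rpow_inv_rpow (by positivity) (by linarith), mul_div_cancel₀ _ ht.ne']
  refine (limitGroundState_le_sub hp.le (by positivity)).trans_lt ?_
  linarith [le_abs_self (limitGroundState p 0)]

/-- The limit `L_{p,u}(t)` of `L_{n,p,u}(t)`. -/
noncomputable def limitConstrained (p u t : ℝ) : ℝ := u * limitGroundState p (t * u ^ (p / 2 - 1))

/-- The limit `L_p(t)` of `L_{n,p}(t)`. -/
noncomputable def limitUnconstrained (p t : ℝ) : ℝ :=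
  sSup ((fun u => limitConstrained p u t) '' Set.Ioi 0)

lemma antitoneOn_limitGroundState_mul_rpow (hp : 2 ≤ p) {t : ℝ} (ht : 0 ≤ t) :
    AntitoneOn (fun u => limitGroundState p (t * u ^ (p / 2 - 1))) (Set.Ici 0) :=
  antitoneOn_comp_mul_rpow (antitoneOn_limitGroundState (zero_le_two.trans hp)) ht (by linarith)

theorem isLUB_limitUnconstrained (hp : 2 < p) {t : ℝ} (ht : 0 < t) :
    IsLUB ((fun u => limitConstrained p u t) '' Set.Ioi 0) (limitUnconstrained p t) := by
  obtain ⟨U, hU, hneg⟩ := exists_limitGroundState_mul_rpow_neg hp ht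
  exact isLUB_csSup (Set.nonempty_Ioi.image _)
    (bddAbove_mul_of_antitoneOn (antitoneOn_limitGroundState_mul_rpow hp.le ht.le) hU hneg.le)

section Sequence

variable {A : (n : ℕ) → Matrix (Fin n) (Fin n) ℝ} {t : ℝ}

theorem tendsto_constrainedGroundStateEnergy (hp : 0 < p) (ht : 0 ≤ t) {u : ℝ} (hu : 0 < u)
    (hA : ∀ s, 0 ≤ s → Tendsto (fun n => unitGroundState p s n (matrixVec (A n))) atTop
      (𝓝 (limitGroundState p s))) :
    Tendsto (fun n => constrainedGroundStateEnergy p u t (A n)) atTop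
      (𝓝 (limitConstrained p u t)) := by
  simp only [constrainedGroundStateEnergy_eq_mul hp hu t]
  exact (hA _ (by positivity)).const_mul u

theorem tendsto_groundStateEnergy (hp : 2 < p) (ht : 0 < t)
    (hA : ∀ s, 0 ≤ s → Tendsto (fun n => unitGroundState p s n (matrixVec (A n))) atTop
      (𝓝 (limitGroundState p s))) :
    Tendsto (fun n => groundStateEnergy p t (A n)) atTop (𝓝 (limitUnconstrained p t)) := by
  obtain ⟨U, hU, hneg⟩ := exists_limitGroundState_mul_rpow_neg hp ht
  refine tendsto_of_isLUB_mul
    (fun n => antitoneOn_unitGroundState_mul_rpow hp.le ht.le (matrixVec (A n)))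
    (antitoneOn_limitGroundState_mul_rpow hp.le ht.le) (fun u hu => hA _ (by positivity)) hU hneg
    (isLUB_limitUnconstrained hp ht) ?_
  filter_upwards [eventually_gt_atTop 0] with n hn using isLUB_groundStateEnergy hn hp ht (A n)

end Sequence

end LimitFormula

section AlmostSure

variable {Ω : Type*} [MeasurableSpace Ω] {P : Measure Ω}

lemma ae_tendsto_zero_of_tsum_eLpNorm_rpow_ne_top {E : Type*} [NormedAddCommGroup E]
    {X : ℕ → Ω → E} (hX : ∀ n, AEStronglyMeasurable (X n) P) {r : ℝ≥0} (hr : r ≠ 0)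
    (hsum : ∑' n, eLpNorm (X n) r P ^ (r : ℝ) ≠ ⊤) :
    ∀ᵐ ω ∂P, Tendsto (fun n => X n ω) atTop (𝓝 0) := by
  have hr₀ : (0 : ℝ) < r := by positivity
  have hmeas : ∀ n, AEMeasurable (fun ω => ‖X n ω‖ₑ ^ (r : ℝ)) P := fun n =>
    (hX n).enorm.pow_const _
  have hlint : ∫⁻ ω, ∑' n, ‖X n ω‖ₑ ^ (r : ℝ) ∂P ≠ ⊤ := by
    rw [lintegral_tsum hmeas]
    simpa only [← eLpNorm_nnreal_pow_eq_lintegral hr] using hsum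
  filter_upwards [ae_lt_top' (AEMeasurable.tsum hmeas) hlint] with ω hω
  have hpow := ENNReal.tendsto_atTop_zero_of_tsum_ne_top hω.ne
  have henorm := hpow.ennrpow_const (r : ℝ)⁻¹
  simp only [ENNReal.rpow_rpow_inv hr₀.ne', ENNReal.zero_rpow_of_pos (inv_pos.2 hr₀)] at henorm
  exact tendsto_zero_iff_enorm_tendsto_zero.2 henorm

lemma IsGaussianMatrix.hasLaw_matrixVec {n : ℕ}
    {G : Ω → Matrix (Fin n) (Fin n) ℝ} (hG : IsGaussianMatrix P G) :
    HasLaw (fun ω => matrixVec (G ω)) (stdGaussian (EuclideanSpace ℝ (Fin n × Fin n))) P := by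
  have htoLp : MeasurePreserving
      (WithLp.toLp 2 : (Fin n × Fin n → ℝ) → EuclideanSpace ℝ (Fin n × Fin n))
      (Measure.pi fun _ => gaussianReal 0 1) (stdGaussian _) :=
    ⟨by fun_prop, map_pi_eq_stdGaussian⟩
  exact htoLp.comp_hasLaw (hG.indep.hasLaw_pi fun ij => hG.law ij.1 ij.2)

variable {p : ℝ}

lemma IsGaussianMatrix.integrable_unitGroundState_matrixVec {n : ℕ}
    {G : Ω → Matrix (Fin n) (Fin n) ℝ} (hG : IsGaussianMatrix P G) (hp : 0 ≤ p) (s : ℝ) :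
    Integrable (fun ω => unitGroundState p s n (matrixVec (G ω))) P := by
  have hlaw := hG.hasLaw_matrixVec
  exact Integrable.comp_aemeasurable (hlaw.map_eq ▸ integrable_unitGroundState hp s n)
    hlaw.aemeasurable

lemma IsGaussianMatrix.eLpNorm_unitGroundState_matrixVec_sub_le {n : ℕ}
    {G : Ω → Matrix (Fin n) (Fin n) ℝ} (hG : IsGaussianMatrix P G) (hp : 0 ≤ p) (s : ℝ)
    {r : ℝ≥0} (hr : 1 ≤ r) :
    eLpNorm (fun ω => unitGroundState p s n (matrixVec (G ω)) - meanGroundState p s n) r P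
      ≤ ENNReal.ofReal (Real.pi / 2)
        * (ENNReal.ofReal (√n)⁻¹ * eLpNorm id r (gaussianReal 0 1)) := by
  have hlaw := hG.hasLaw_matrixVec
  have hmeas := (integrable_unitGroundState hp s n).1.sub
    (aestronglyMeasurable_const (b := meanGroundState p s n))
  refine le_of_eq_of_le ?_ (eLpNorm_unitGroundState_sub_le hp s n hr)
  rw [← hlaw.map_eq, eLpNorm_map_measure (hlaw.map_eq ▸ hmeas) hlaw.aemeasurable]
  rfl

lemma IsGaussianMatrix.integrable_constrainedGroundStateEnergy {n : ℕ}
    {G : Ω → Matrix (Fin n) (Fin n) ℝ} (hG : IsGaussianMatrix P G) (hp : 0 < p) {u : ℝ}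
    (hu : 0 < u) (t : ℝ) : Integrable (fun ω => constrainedGroundStateEnergy p u t (G ω)) P := by
  simp only [constrainedGroundStateEnergy_eq_mul hp hu t]
  exact (hG.integrable_unitGroundState_matrixVec hp.le _).const_mul u

lemma IsGaussianMatrix.integral_constrainedGroundStateEnergy {n : ℕ}
    {G : Ω → Matrix (Fin n) (Fin n) ℝ} (hG : IsGaussianMatrix P G) (hp : 0 < p) {u : ℝ}
    (hu : 0 < u) (t : ℝ) : ∫ ω, constrainedGroundStateEnergy p u t (G ω) ∂P
      = u * meanGroundState p (t * u ^ (p / 2 - 1)) n := by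
  simp only [constrainedGroundStateEnergy_eq_mul hp hu t]
  rw [integral_const_mul]
  exact congrArg _ (hG.hasLaw_matrixVec.integral_comp (integrable_unitGroundState hp.le _ n).1)

variable {G : (n : ℕ) → Ω → Matrix (Fin n) (Fin n) ℝ}

theorem tendsto_integral_constrainedGroundStateEnergy (hG : ∀ n, IsGaussianMatrix P (G n))
    (hp : 0 < p) {u t : ℝ} (hu : 0 < u) (ht : 0 ≤ t) :
    Tendsto (fun n => ∫ ω, constrainedGroundStateEnergy p u t (G n ω) ∂P) atTop
      (𝓝 (limitConstrained p u t)) := by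
  simp only [(hG _).integral_constrainedGroundStateEnergy hp hu t]
  exact (tendsto_meanGroundState hp.le (by positivity)).const_mul u

lemma tsum_ofReal_inv_sqrt_rpow_four_ne_top :
    ∑' n : ℕ, ENNReal.ofReal (√n)⁻¹ ^ (4 : ℝ) ≠ ⊤ := by
  have hterm : ∀ n : ℕ, ENNReal.ofReal (√n)⁻¹ ^ (4 : ℝ) = ENNReal.ofReal (1 / (n : ℝ) ^ 2) :=
    fun n => by
      rw [ENNReal.ofReal_rpow_of_nonneg (by positivity) (by norm_num)]
      rw [show (4 : ℝ) = (4 : ℕ) by norm_num, Real.rpow_natCast]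
      congr 1
      rw [inv_pow, show √(n : ℝ) ^ 4 = (√n ^ 2) ^ 2 by ring, Real.sq_sqrt n.cast_nonneg, one_div]
  simp only [hterm]
  exact (Real.summable_one_div_nat_pow.2 one_lt_two).tsum_ofReal_ne_top

lemma ae_tendsto_unitGroundState (hG : ∀ n, IsGaussianMatrix P (G n)) (hp : 0 ≤ p) {s : ℝ}
    (hs : 0 ≤ s) : ∀ᵐ ω ∂P, Tendsto (fun n => unitGroundState p s n (matrixVec (G n ω))) atTop
      (𝓝 (limitGroundState p s)) := by
  set X : ℕ → Ω → ℝ := fun n ω => unitGroundState p s n (matrixVec (G n ω)) - meanGroundState p s n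
  have hX : ∀ n, AEStronglyMeasurable (X n) P := fun n =>
    ((hG n).integrable_unitGroundState_matrixVec hp s).1.sub aestronglyMeasurable_const
  set C := eLpNorm id (4 : ℝ≥0) (gaussianReal 0 1)
  have hC : C ≠ ⊤ := (memLp_id_gaussianReal 4).eLpNorm_ne_top
  have hbound : ∀ n, eLpNorm (X n) (4 : ℝ≥0) P ^ ((4 : ℝ≥0) : ℝ)
      ≤ (ENNReal.ofReal (Real.pi / 2) * C) ^ (4 : ℝ) * ENNReal.ofReal (√n)⁻¹ ^ (4 : ℝ) := by
    intro n
    rw [← ENNReal.mul_rpow_of_nonneg _ _ (by norm_num), mul_assoc, mul_comm C]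
    exact ENNReal.rpow_le_rpow
      ((hG n).eLpNorm_unitGroundState_matrixVec_sub_le hp s (by norm_num)) (by norm_num)
  have hsum : ∑' n, eLpNorm (X n) (4 : ℝ≥0) P ^ ((4 : ℝ≥0) : ℝ) ≠ ⊤ := by
    refine ne_top_of_le_ne_top ?_ (ENNReal.tsum_le_tsum hbound)
    rw [ENNReal.tsum_mul_left]
    exact ENNReal.mul_ne_top (ENNReal.rpow_ne_top_of_nonneg (by norm_num)
      (ENNReal.mul_ne_top ENNReal.ofReal_ne_top hC)) tsum_ofReal_inv_sqrt_rpow_four_ne_top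
  filter_upwards [ae_tendsto_zero_of_tsum_eLpNorm_rpow_ne_top hX (by norm_num) hsum] with ω hω
  simpa only [X, sub_add_cancel, zero_add] using hω.add (tendsto_meanGroundState hp hs)

theorem ae_forall_tendsto_unitGroundState (hG : ∀ n, IsGaussianMatrix P (G n)) (hp : 0 ≤ p) :
    ∀ᵐ ω ∂P, ∀ s, 0 ≤ s → Tendsto (fun n => unitGroundState p s n (matrixVec (G n ω))) atTop
      (𝓝 (limitGroundState p s)) := by
  have hrat : ∀ᵐ ω ∂P, ∀ q : ℚ, 0 ≤ (q : ℝ) → Tendsto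
      (fun n => unitGroundState p q n (matrixVec (G n ω))) atTop (𝓝 (limitGroundState p q)) :=
    ae_all_iff.2 fun q => eventually_imp_distrib_left.2 fun hq =>
      ae_tendsto_unitGroundState hG hp hq
  filter_upwards [hrat] with ω hω s hs
  rcases hs.eq_or_lt with rfl | hs
  · simpa only [Rat.cast_zero] using hω 0 (by rw [Rat.cast_zero])
  have hcont : ContinuousAt (limitGroundState p) s :=
    (((convexOn_limitGroundState hp).subset Set.Ioi_subset_Ici_self (convex_Ioi 0)).continuousOn
      isOpen_Ioi).continuousAt (Ioi_mem_nhds hs)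
  refine tendsto_of_antitone_of_dense (fun n => antitone_unitGroundState hp (matrixVec (G n ω)))
    hcont Rat.denseRange_cast ?_
  filter_upwards [Ioi_mem_nhds hs]
  rintro _ hq ⟨q, rfl⟩
  exact hω q (le_of_lt hq)

end AlmostSure

theorem theorem1p4 (p : ℝ) (hp : 2 < p) :
    ∃ (Lpu : ℝ → ℝ → ℝ) (Lp : ℝ → ℝ),
      (∀ t : ℝ, 0 < t → IsLUB ((fun u => Lpu u t) '' Set.Ioi 0) (Lp t)) ∧
      ∀ (Ω : Type*) [MeasurableSpace Ω] (P : Measure Ω) [IsProbabilityMeasure P]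
        (G : (n : ℕ) → Ω → Matrix (Fin n) (Fin n) ℝ),
        (∀ n, IsGaussianMatrix P (G n)) →
        (∀ u t : ℝ, 0 < u → 0 < t →
          (∀ n, Integrable (fun ω => constrainedGroundStateEnergy p u t (G n ω)) P) ∧
          Tendsto (fun n => ∫ ω, constrainedGroundStateEnergy p u t (G n ω) ∂P)
            atTop (𝓝 (Lpu u t))) ∧
        ∀ᵐ ω ∂P,
          (∀ u t : ℝ, 0 < u → 0 < t →
            Tendsto (fun n => constrainedGroundStateEnergy p u t (G n ω))
              atTop (𝓝 (Lpu u t))) ∧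
          (∀ t : ℝ, 0 < t →
            Tendsto (fun n => groundStateEnergy p t (G n ω)) atTop (𝓝 (Lp t))) := by
  have hp₀ : 0 < p := by linarith
  refine ⟨limitConstrained p, limitUnconstrained p, fun t ht => isLUB_limitUnconstrained hp ht,
    fun Ω _ P _ G hG => ⟨fun u t hu ht => ⟨fun n => ?_, ?_⟩, ?_⟩⟩
  · exact (hG n).integrable_constrainedGroundStateEnergy hp₀ hu t
  · exact tendsto_integral_constrainedGroundStateEnergy hG hp₀ hu ht.le
  · filter_upwards [ae_forall_tendsto_unitGroundState hG hp₀.le] with ω hω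
    exact ⟨fun u t hu ht => tendsto_constrainedGroundStateEnergy hp₀ ht.le hu hω,
      fun t ht => tendsto_groundStateEnergy hp ht hω⟩
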